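/- Consider the following three algorithms on a sequence $(a_1,\dots,a_n)$ of numbers. (A) Bubble sort: for $i=1,\dots,n$ (the $i$-th pass), for $j=1,\dots,n-i$: if $a_j>a_{j+1}$, swap $a_j$ and $a_{j+1}$. (B) Bubble sort with early termination: the same, except that a Boolean variable records whether a swap was made in the current pass, and the algorithm returns at the end of the first pass in which no swap was made. (C) The variant of (B): in the $i$-th pass, for $j=1,\dots,n-i$, if $a_j>a_{j+1}$, swap $a_j,a_{j+1}$, record that a swap was made and leave this loop; if the loop ended without a swap, return; otherwise, with $j$ the index of that swap, continue the pass with $k=j+1,\dots,n-i$: if $a_k>a_{k+1}$, swap $a_k,a_{k+1}$. Let the input be a uniformly random permutation of $n$ distinct numbers, and let $A_n$, $B_n$, $C_n$ be the expected numbers of comparisons of adjacent elements (executions of a test $a_j>a_{j+1}$) made by (A), (B), (C). Put $$E_n = n-\frac52\sqrt{\frac{\pi n}{2}}+\frac{10}{3}-\frac{17}{16}\sqrt{\frac{\pi}{2n}}-\frac{4}{135\,n}.$$ Then, as $n\to\infty$, $$A_n-B_n = E_n \pm\Theta\!\left(\frac{1}{n\sqrt n}\right),\qquad A_n-C_n =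 E_n \pm\Theta\!\left(\frac{1}{n\sqrt n}\right),$$ that is, there are constants $0<c\le C$ such that $c\,n^{-3/2}\le |A_n-B_n-E_n|\le C\,n^{-3/2}$ and $c\,n^{-3/2}\le |A_n-C_n-E_n|\le C\,n^{-3/2}$ for all sufficiently large $n$. -/

import Mathlib

open Filter Asymptotics Finset

namespace BubbleSort

/-- The state of a run on a sequence of length `n`: the current contents of the sequence and the
number of comparisons of adjacent elements executed so far. Positions are numbered from `0`. -/
structure State (n : ℕ) (α : Type*) where
  arr : Fin n → α
  comparisons : ℕ

/-- The initial state: the input sequence, and no comparison made yet. -/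
def start {n : ℕ} {α : Type*} (a : Fin n → α) : State n α := ⟨a, 0⟩

/-- `if a_j > a_{j+1} then swap a_j, a_{j+1}`, executed once. It costs one comparison of adjacent
elements; the returned Boolean says whether the swap took place. The algorithms below only use
indices with `j + 1 < n`, so that the last branch is never reached. -/
def compareSwap {n : ℕ} {α : Type*} [LinearOrder α] (s : State n α) (j : ℕ) : State n α × Bool :=
  if h : j + 1 < n then
    if s.arr ⟨j, by omega⟩ > s.arr ⟨j + 1, h⟩ then
      (⟨s.arr ∘ Equiv.swap ⟨j, by omega⟩ ⟨j + 1, h⟩, s.comparisons + 1⟩, true)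
    else
      (⟨s.arr, s.comparisons + 1⟩, false)
  else (s, false)

/-- The loop `for j, j + 1, …, j + len - 1: compare and swap`, without any Boolean variable. -/
def sweep {n : ℕ} {α : Type*} [LinearOrder α] : (len j : ℕ) → State n α → State n α
  | 0, _, s => s
  | len + 1, j, s => sweep len (j + 1) (compareSwap s j).1

/-- The same loop, with a Boolean variable `ξ` which is set to true at every swap. -/
def flaggedSweep {n : ℕ} {α : Type*} [LinearOrder α] :
    (len j : ℕ) → State n α → (ξ : Bool) → State n α × Bool
  | 0, _, s, ξ => (s, ξ)
  | len + 1, j, s, ξ =>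
    let r := compareSwap s j
    flaggedSweep len (j + 1) r.1 (if r.2 then true else ξ)

/-- The same loop, left (by a `break`) right after the first swap. The second component is the
index `j` at which the swap took place, or `none` if the loop ended without a swap. -/
def scan {n : ℕ} {α : Type*} [LinearOrder α] :
    (len j : ℕ) → State n α → State n α × Option ℕ
  | 0, _, s => (s, none)
  | len + 1, j, s =>
    let r := compareSwap s j
    if r.2 then (r.1, some j) else scan len (j + 1) r.1

/-- The last `m` passes of plain bubble sort. The first of them, which is pass number
`i = n - (m - 1)` of the whole run, inspects the `n - i = m - 1` leading adjacent pairs. -/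
def plainPasses {n : ℕ} {α : Type*} [LinearOrder α] : (m : ℕ) → State n α → State n α
  | 0, s => s
  | m + 1, s => plainPasses m (sweep m 0 s)

/-- As `plainPasses`, but `ξ` is reset to false at the start of each pass, and the run returns at
the end of a pass in which no swap was made. -/
def optimizedPasses {n : ℕ} {α : Type*} [LinearOrder α] : (m : ℕ) → State n α → State n α
  | 0, s => s
  | m + 1, s =>
    let r := flaggedSweep m 0 s false
    if r.2 then optimizedPasses m r.1 else r.1

/-- As `plainPasses`, but each pass is split: it is first executed up to and including its first
swap. If there was none, the run returns; if there was one, at index `j`, the pass is resumed at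
index `j + 1` by the loop without a Boolean variable. -/
def variantPasses {n : ℕ} {α : Type*} [LinearOrder α] : (m : ℕ) → State n α → State n α
  | 0, s => s
  | m + 1, s =>
    match scan m 0 s with
    | (s', none) => s'
    | (s', some j) => variantPasses m (sweep (m - (j + 1)) (j + 1) s')

/-- Bubble sort: `for i from 1 to n, for j from 1 to n - i, compare and swap`. -/
def plain {n : ℕ} {α : Type*} [LinearOrder α] (a : Fin n → α) : State n α :=
  plainPasses n (start a)

/-- Bubble sort with early termination when a pass makes no swaps. -/
def optimized {n : ℕ} {α : Type*} [LinearOrder α] (a : Fin n → α) : State n α :=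
  optimizedPasses n (start a)

/-- The variant of bubble sort with early termination, in which the Boolean variable is assigned
only at the first swap of a pass. -/
def variant {n : ℕ} {α : Type*} [LinearOrder α] (a : Fin n → α) : State n α :=
  variantPasses n (start a)

/-- The expected number of comparisons of adjacent elements which `algorithm` makes when its input
is a uniformly random permutation of `x 0, …, x (n - 1)`. -/
noncomputable def expectedComparisons {n : ℕ} {α : Type*}
    (algorithm : (Fin n → α) → State n α) (x : Fin n → α) : ℝ :=
  (∑ σ : Equiv.Perm (Fin n), ((algorithm (x ∘ σ)).comparisons : ℝ)) / (n.factorial : ℝ)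

/-- The explicit part of the expansion of the saving. -/
noncomputable def expansion (n : ℕ) : ℝ :=
  n - 5 / 2 * √(Real.pi * n / 2) + 10 / 3 - 17 / 16 * √(Real.pi / (2 * n)) - 4 / (135 * n)

end BubbleSort

/-! Combinatorial part. Attach to a sequence its inversion table: for each position, the number of
larger entries before it (`exceeding`). A pass shifts this table one place to the left and lowers
every positive entry by one. Hence `t` passes sort the input exactly when all entries are at most
`t`; pass `t + 1` then makes no swap, and pass `t + 2`, which would cost `n - 2 - t` comparisons, is
omitted. For a uniform permutation the table entries are independent, the one at position `j`
uniform on `0, …, j`, so this event has probability `(t+1)! (t+1)^(n-t-1) / n!`. With `k = n - 1 -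
t` the expected saving is `1 + ∑ (k - 1) w_k`, where `w_k = sortedProb n k`. Algorithm (C) performs
the same comparisons as (B), so one sum serves both.

Asymptotic part. The `w_k` have the profile `exp (-k²/(2n))`. They are compared not with the
Gaussian but with `v_k = C(4n, 2n+k) / C(4n, 2n)` (`centralRatio (2 * n) k`), which has the same
profile and can be summed exactly: `∑ v_k` is expressed by `4^(2n) / C(4n, 2n)`, and the recurrence
`v_{k+1} (2n+k+1) = v_k (2n-k)` gives an exact summation by parts. Put `s = 1/√n`, `x = k s`.
Expanding the logarithm of `w_k / v_k` and exponentiating gives `w_k / v_k = ratioPoly s x +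
O(s^6)`, up to powers of `1 + x` (`exists_abs_sortedProb_sub_le`). The polynomial `summationPoly` is
a discrete antiderivative of `(k - 1) ratioPoly` up to a multiple `c(s)` of the constant 1 and an
error `O(s^5)` (`small_summationPoly`). Summation against `v_k` costs a factor `1/s`, so the total
error is `O(n^(-2))` (`exists_abs_sum_sub_le`).

What remains is `2n summationPoly s 0 + c(s) ∑ v_k`. Wallis' product, made quantitative by
monotonicity, expands `∑ v_k`. All terms of `expansion` cancel, and the next one is `347/4608 √(2π)
n^(-3/2)`; since its coefficient is nonzero, the order is exact. -/

namespace BubbleSort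

/-! ### The two early-terminating algorithms coincide -/

section Passes

variable {n : ℕ} {α : Type*} [LinearOrder α]

theorem flaggedSweep_fst (len j : ℕ) (s : State n α) (ξ : Bool) :
    (flaggedSweep len j s ξ).1 = sweep len j s := by
  induction len generalizing j s ξ with
  | zero => rfl
  | succ len ih => simp only [flaggedSweep, sweep, ih]

theorem flaggedSweep_true (len j : ℕ) (s : State n α) :
    flaggedSweep len j s true = (sweep len j s, true) := by
  induction len generalizing j s with
  | zero => rfl
  | succ len ih => simp only [flaggedSweep, sweep, ite_self, ih]

/-- After the first swap the flag stays true whatever follows, so the rest of the flagged loop is a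
plain sweep: precisely the loop that the variant resumes at `i + 1`. -/
theorem scan_spec (len j : ℕ) (s : State n α) :
    (∀ s', scan len j s = (s', none) → flaggedSweep len j s false = (s', false)) ∧
    (∀ s' i, scan len j s = (s', some i) →
      flaggedSweep len j s false = (sweep (j + len - (i + 1)) (i + 1) s', true)) := by
  induction len generalizing j s with
  | zero => simp [scan, flaggedSweep]
  | succ len ih =>
    simp only [scan, flaggedSweep]
    by_cases hb : (compareSwap s j).2 = true
    · simp only [hb, if_true, flaggedSweep_true]
      refine ⟨by simp, fun s' i h => ?_⟩
      simp only [Prod.mk.injEq, Option.some.injEq] at h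
      obtain ⟨rfl, rfl⟩ := h
      rw [show j + (len + 1) - (j + 1) = len by omega]
    · simp only [hb]
      refine ⟨(ih (j + 1) _).1, fun s' i h => ?_⟩
      have := (ih (j + 1) _).2 s' i h
      rw [show j + (len + 1) - (i + 1) = j + 1 + len - (i + 1) by omega]
      simpa using this

theorem variantPasses_eq_optimizedPasses (m : ℕ) (s : State n α) :
    variantPasses m s = optimizedPasses m s := by
  induction m generalizing s with
  | zero => rfl
  | succ m ih =>
    have h := scan_spec m 0 s
    rw [variantPasses, optimizedPasses]
    rcases hs : scan m 0 s with ⟨s', _ | i⟩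
    · simp [h.1 s' hs]
    · have := h.2 s' i hs
      simp only [zero_add] at this
      simp [this, ih]

/-! ### Inversion tables and the effect of a pass -/

open Classical in
/-- The number of entries which precede position `i` and exceed the entry there; it is `0` if `i`
is not a position. -/
noncomputable def exceeding (a : Fin n → α) (i : ℕ) : ℕ :=
  #{k : Fin n | (k : ℕ) < i ∧ ∃ h : i < n, a ⟨i, h⟩ < a k}

theorem exceeding_eq_zero_iff (a : Fin n → α) {i : ℕ} (hi : i < n) :
    exceeding a i = 0 ↔ ∀ k : Fin n, (k : ℕ) < i → a k ≤ a ⟨i, hi⟩ := by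
  classical
  simp [exceeding, Finset.filter_eq_empty_iff, hi]

theorem exceeding_of_le (a : Fin n → α) {i : ℕ} (hi : n ≤ i) : exceeding a i = 0 := by
  classical
  simp [exceeding, not_lt.2 hi]

theorem exceeding_zero (a : Fin n → α) : exceeding a 0 = 0 := by
  simp [exceeding]

theorem exceeding_comp_swap (a : Fin n → α) {j : ℕ} (hj : j + 1 < n) {i : ℕ} (h1 : i ≠ j)
    (h2 : i ≠ j + 1) :
    exceeding (a ∘ Equiv.swap ⟨j, by omega⟩ ⟨j + 1, hj⟩) i = exceeding a i := by
  classical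
  unfold exceeding
  refine Finset.card_equiv (Equiv.swap ⟨j, by omega⟩ ⟨j + 1, hj⟩) fun k => ?_
  simp only [Finset.mem_filter, Finset.mem_univ, true_and, Function.comp]
  have hlt : ((Equiv.swap (⟨j, by omega⟩ : Fin n) ⟨j + 1, hj⟩ k : Fin n) : ℕ) < i ↔ (k : ℕ) < i := by
    rw [Equiv.swap_apply_def]
    split_ifs with e1 e2
    · subst e1; simp; omega
    · subst e2; simp; omega
    · rfl
  have hi : ∀ h : i < n, Equiv.swap (⟨j, by omega⟩ : Fin n) ⟨j + 1, hj⟩ ⟨i, h⟩ = ⟨i, h⟩ := fun h =>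
    Equiv.swap_apply_of_ne_of_ne (by simpa using h1) (by simpa using h2)
  rw [hlt]
  simp only [hi]

/-- The smaller entry moves one place to the left and loses exactly one larger predecessor, the
entry it was swapped with. -/
theorem exceeding_comp_swap_left (a : Fin n → α) {j : ℕ} (hj : j + 1 < n)
    (hlt : a ⟨j + 1, hj⟩ < a ⟨j, by omega⟩) :
    exceeding (a ∘ Equiv.swap ⟨j, by omega⟩ ⟨j + 1, hj⟩) j + 1 = exceeding a (j + 1) := by
  classical
  have hj' : j < n := by omega
  have hins : ({k : Fin n | (k : ℕ) < j + 1 ∧ ∃ h : j + 1 < n, a ⟨j + 1, h⟩ < a k} : Finset (Fin n))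
      = insert ⟨j, hj'⟩ ({k : Fin n | (k : ℕ) < j ∧ ∃ h : j < n,
        (a ∘ Equiv.swap ⟨j, hj'⟩ ⟨j + 1, hj⟩) ⟨j, h⟩
          < (a ∘ Equiv.swap ⟨j, hj'⟩ ⟨j + 1, hj⟩) k} : Finset (Fin n)) := by
    ext k
    simp only [Finset.mem_filter, Finset.mem_univ, true_and, Finset.mem_insert, Function.comp,
      Equiv.swap_apply_left]
    rcases lt_trichotomy (k : ℕ) j with h | h | h
    · have hk1 : k ≠ ⟨j, hj'⟩ := fun e => by simp [e] at h
      have hk2 : k ≠ ⟨j + 1, hj⟩ := fun e => by simp [e] at h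
      rw [Equiv.swap_apply_of_ne_of_ne hk1 hk2]
      simp [hk1, h, hj, show (k : ℕ) < j + 1 by omega, show j < n by omega]
    · have hk : k = ⟨j, hj'⟩ := Fin.ext h
      rw [hk]
      simp [hj, hlt]
    · have hk1 : k ≠ ⟨j, hj'⟩ := fun e => by simp [e] at h
      simp [hk1, not_lt.2 h.le, show ¬ (k : ℕ) < j + 1 by omega]
  unfold exceeding
  rw [hins, Finset.card_insert_of_notMem (by simp)]

/-- The hypothesis `h0` says that position `j` holds the maximum of the prefix up to `j`. This is
the loop invariant of a pass: the test moves the prefix maximum to `j + 1`, so the entry of the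
table there becomes `0`. -/
theorem exceeding_compareSwap (s : State n α) {j : ℕ} (hj : j + 1 < n)
    (h0 : exceeding s.arr j = 0) (i : ℕ) :
    exceeding (compareSwap s j).1.arr i =
      if i = j then exceeding s.arr (j + 1) - 1 else if i = j + 1 then 0
        else exceeding s.arr i := by
  classical
  have hmax := (exceeding_eq_zero_iff s.arr (by omega : j < n)).1 h0
  unfold compareSwap
  rw [dif_pos hj]
  split_ifs with hgt h1 h2 h1 h2
  · subst h1
    have := exceeding_comp_swap_left s.arr hj hgt
    simp only
    omega
  · subst h2
    simp only
    rw [exceeding_eq_zero_iff _ hj]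
    intro k hk
    simp only [Function.comp, Equiv.swap_apply_right]
    rw [Equiv.swap_apply_def]
    split_ifs with e1 e2
    · exact hgt.le
    · exact le_rfl
    · exact hmax k (by
        have : (k : ℕ) ≠ j := fun e => e1 (Fin.ext e)
        omega)
  · exact exceeding_comp_swap s.arr hj h1 h2
  all_goals
    have h10 : exceeding s.arr (j + 1) = 0 := by
      rw [exceeding_eq_zero_iff _ hj]
      intro k hk
      rcases Nat.lt_succ_iff_lt_or_eq.1 hk with h | h
      · exact (hmax k h).trans (not_lt.1 hgt)
      · have hk : k = ⟨j, by omega⟩ := Fin.ext h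
        rw [hk]
        exact not_lt.1 hgt
  · subst h1; simp [h0, h10]
  · subst h2; simp [h10]
  · rfl

theorem compareSwap_comparisons (s : State n α) {j : ℕ} (hj : j + 1 < n) :
    (compareSwap s j).1.comparisons = s.comparisons + 1 := by
  unfold compareSwap
  rw [dif_pos hj]
  split_ifs <;> rfl

theorem compareSwap_snd (s : State n α) {j : ℕ} (hj : j + 1 < n)
    (h0 : exceeding s.arr j = 0) :
    (compareSwap s j).2 = true ↔ exceeding s.arr (j + 1) ≠ 0 := by
  have hmax := (exceeding_eq_zero_iff s.arr (by omega : j < n)).1 h0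
  unfold compareSwap
  rw [dif_pos hj, Ne, exceeding_eq_zero_iff _ hj]
  split_ifs with hgt
  · simp only [true_iff, not_forall, not_le]
    exact ⟨⟨j, by omega⟩, by simp, hgt⟩
  · simp only [false_iff, not_not]
    intro k hk
    rcases Nat.lt_succ_iff_lt_or_eq.1 hk with h | h
    · exact (hmax k h).trans (not_lt.1 hgt)
    · have hk : k = ⟨j, by omega⟩ := Fin.ext h
      rw [hk]
      exact not_lt.1 hgt

theorem sweep_comparisons (len j : ℕ) (s : State n α) (h : j + len < n) :
    (sweep len j s).comparisons = s.comparisons + len := by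
  induction len generalizing j s with
  | zero => rfl
  | succ len ih =>
    rw [sweep, ih _ _ (by omega), compareSwap_comparisons _ (by omega)]
    omega

theorem exceeding_sweep (len j : ℕ) (s : State n α) (h : j + len < n)
    (h0 : exceeding s.arr j = 0) (i : ℕ) :
    exceeding (sweep len j s).arr i =
      if j ≤ i ∧ i < j + len then exceeding s.arr (i + 1) - 1 else if i = j + len then 0
        else exceeding s.arr i := by
  induction len generalizing j s with
  | zero =>
    simp only [sweep, add_zero]
    rw [if_neg (by omega)]
    split_ifs with hi
    · rw [hi, h0]
    · rfl
  | succ len ih =>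
    have hc := exceeding_compareSwap s (by omega : j + 1 < n) h0
    rw [sweep, ih _ _ (by omega) (by rw [hc]; simp)]
    simp only [hc]
    by_cases h1 : i = j
    · subst h1
      rw [if_neg (by omega), if_neg (by omega), if_pos rfl, if_pos (by omega)]
    by_cases h2 : j + 1 ≤ i ∧ i < j + 1 + len
    · rw [if_pos h2, if_neg (by omega), if_neg (by omega), if_pos (by omega)]
    by_cases h3 : i = j + 1 + len
    · rw [if_neg h2, if_pos h3, if_neg (by omega), if_pos (by omega)]
    · rw [if_neg h2, if_neg h3, if_neg h1, if_neg (by omega), if_neg (by omega), if_neg (by omega)]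

theorem flaggedSweep_snd (len j : ℕ) (s : State n α) (h : j + len < n)
    (h0 : exceeding s.arr j = 0) :
    (flaggedSweep len j s false).2 = true ↔
      ∃ i, j ≤ i ∧ i < j + len ∧ exceeding s.arr (i + 1) ≠ 0 := by
  induction len generalizing j s with
  | zero =>
    simp only [flaggedSweep, Bool.false_eq_true, false_iff]
    rintro ⟨i, h1, h2, -⟩
    omega
  | succ len ih =>
    have hc := exceeding_compareSwap s (by omega : j + 1 < n) h0
    have hs := compareSwap_snd s (by omega : j + 1 < n) h0
    simp only [flaggedSweep]
    by_cases hb : (compareSwap s j).2 = true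
    · simp only [hb, if_true, flaggedSweep_true, true_iff]
      exact ⟨j, le_rfl, by omega, hs.1 hb⟩
    · have hz : exceeding s.arr (j + 1) = 0 := by
        by_contra hne
        exact hb (hs.2 hne)
      simp only [hb]
      rw [if_neg (by simp), ih _ _ (by omega) (by rw [hc]; simp)]
      constructor
      · rintro ⟨i, h1, h2, h3⟩
        rw [hc, if_neg (by omega), if_neg (by omega)] at h3
        exact ⟨i, by omega, by omega, h3⟩
      · rintro ⟨i, h1, h2, h3⟩
        have : i ≠ j := fun e => h3 (e ▸ hz)
        refine ⟨i, by omega, by omega, ?_⟩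
        rwa [hc, if_neg (by omega), if_neg (by omega)]

/-! ### Comparisons saved by early termination -/

theorem plainPasses_comparisons (m : ℕ) (s : State n α) (hm : m ≤ n) :
    (plainPasses m s).comparisons = s.comparisons + ∑ t ∈ range (m - 1), (m - 1 - t) := by
  induction m generalizing s with
  | zero => rfl
  | succ m ih =>
    rw [plainPasses, ih _ (by omega), sweep_comparisons _ _ _ (by omega)]
    rcases m with _ | m
    · simp
    · simp only [Nat.add_sub_cancel]
      rw [Finset.sum_range_succ' _ m]
      simp only [Nat.add_sub_add_right, Nat.sub_zero]
      omega

open Classical in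
/-- The comparisons saved by early termination. -/
theorem plainPasses_comparisons_eq (m : ℕ) (s : State n α) (hm : m ≤ n)
    (h0 : ∀ i, m ≤ i → exceeding s.arr i = 0) :
    (plainPasses m s).comparisons = (optimizedPasses m s).comparisons +
      ∑ t ∈ range (m - 1), if ∀ i, exceeding s.arr i ≤ t then m - 2 - t else 0 := by
  induction m generalizing s with
  | zero => rfl
  | succ m ih =>
    have hz := exceeding_zero s.arr
    have hs := exceeding_sweep m 0 s (by omega) hz
    have hf := flaggedSweep_snd m 0 s (by omega) hz
    -- Beyond the reach of the pass the table is zero by `h0`, so with truncated subtraction the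
    -- shift formula holds at every index.
    have hs' : ∀ i, exceeding (sweep m 0 s).arr i = exceeding s.arr (i + 1) - 1 := by
      intro i
      rw [hs]
      split_ifs with h1 h2
      · rfl
      · rw [h0 _ (by omega)]
      · rw [h0 _ (by omega), h0 _ (by omega)]
    rw [plainPasses, optimizedPasses]
    simp only [flaggedSweep_fst]
    by_cases hb : (flaggedSweep m 0 s false).2 = true
    · rw [if_pos hb, ih _ (by omega) (fun i hi => by rw [hs', h0 _ (by omega)])]
      congr 1
      obtain ⟨i, -, -, hi⟩ := hf.1 hb
      rcases m with _ | m
      · simp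
      · simp only [Nat.add_sub_cancel]
        -- A swap occurred, so some entry is positive and the summand `t = 0` vanishes; the others
        -- are those of the table after the pass, with `t` shifted by one.
        rw [Finset.sum_range_succ' _ m, if_neg (fun h => hi (Nat.le_zero.1 (h _))), add_zero]
        refine Finset.sum_congr rfl fun t _ => ?_
        have : (∀ i, exceeding (sweep (m + 1) 0 s).arr i ≤ t) ↔ ∀ i, exceeding s.arr i ≤ t + 1 := by
          constructor
          · intro h i
            rcases i with _ | i
            · simp [hz]
            · have := h i
              rw [hs'] at this
              omega
          · intro h i
            rw [hs']
            have := h (i + 1)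
            omega
        simp only [this]
        congr 1
        omega
    -- No swap: the table is zero and all `m` remaining passes are saved. The claimed sum has one
    -- more summand than their cost, and that summand is `0`.
    · rw [if_neg hb, plainPasses_comparisons _ _ (by omega)]
      congr 1
      have hall : ∀ i, exceeding s.arr i = 0 := by
        intro i
        rcases i with _ | i
        · exact hz
        · by_contra hne
          by_cases hi : i < m
          · exact hb (hf.2 ⟨i, by omega, by omega, hne⟩)
          · exact hne (h0 _ (by omega))
      rcases m with _ | m
      · simp
      · simp only [hall, Nat.zero_le, implies_true, if_true, Nat.add_sub_cancel]
        rw [Finset.sum_range_succ]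
        simp

end Passes

/-! ### Counting permutations with a bounded inversion table -/

theorem exceeding_strictMono_comp {n : ℕ} {α β : Type*} [LinearOrder α] [LinearOrder β]
    {g : α → β} (hg : StrictMono g) (a : Fin n → α) (i : ℕ) :
    exceeding (g ∘ a) i = exceeding a i := by
  simp only [exceeding, Function.comp, hg.lt_iff_lt]

theorem exceeding_snoc {n : ℕ} {α : Type*} [LinearOrder α] (a : Fin n → α) (p : α) {i : ℕ}
    (hi : i < n) : exceeding (Fin.snoc a p : Fin (n + 1) → α) i = exceeding a i := by
  classical
  unfold exceeding
  symm
  refine Finset.card_bij (fun k _ => Fin.castSucc k) ?_ (fun _ _ _ _ h => Fin.castSucc_injective _ h)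
    ?_
  · intro k hk
    simp only [Finset.mem_filter, Finset.mem_univ, true_and] at hk ⊢
    obtain ⟨h1, h2, h3⟩ := hk
    refine ⟨h1, by omega, ?_⟩
    have : (⟨i, by omega⟩ : Fin (n + 1)) = Fin.castSucc ⟨i, hi⟩ := rfl
    rw [this, Fin.snoc_castSucc, Fin.snoc_castSucc]
    exact h3
  · intro k hk
    simp only [Finset.mem_filter, Finset.mem_univ, true_and] at hk
    obtain ⟨h1, h2, h3⟩ := hk
    obtain ⟨k, rfl⟩ : ∃ l : Fin n, Fin.castSucc l = k := ⟨⟨k, by omega⟩, rfl⟩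
    refine ⟨k, ?_, rfl⟩
    have : (⟨i, by omega⟩ : Fin (n + 1)) = Fin.castSucc ⟨i, hi⟩ := rfl
    rw [this, Fin.snoc_castSucc, Fin.snoc_castSucc] at h3
    simp only [Finset.mem_filter, Finset.mem_univ, true_and]
    exact ⟨h1, hi, h3⟩

theorem exceeding_perm_last {n : ℕ} (σ : Equiv.Perm (Fin (n + 1))) :
    exceeding σ n = n - σ (Fin.last n) := by
  classical
  have : #(Finset.Ioi (σ (Fin.last n))) = n - σ (Fin.last n) := by
    rw [Fin.card_Ioi]
    omega
  rw [← this, exceeding]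
  refine Finset.card_equiv σ fun k => ?_
  simp only [Finset.mem_filter, Finset.mem_univ, true_and, Finset.mem_Ioi]
  constructor
  · rintro ⟨_, _, h⟩
    exact h
  · intro h
    refine ⟨?_, by omega, h⟩
    have : k ≠ Fin.last n := fun e => by simp [e] at h
    exact Fin.val_lt_last this

/-- The permutation with value `p` at the last position, and the pattern `τ` before it. -/
noncomputable def snocPerm {n : ℕ} (q : Fin (n + 1) × Equiv.Perm (Fin n)) :
    Equiv.Perm (Fin (n + 1)) :=
  Equiv.ofBijective (Fin.snoc (q.1.succAbove ∘ q.2) q.1 : Fin (n + 1) → Fin (n + 1)) <| by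
    refine Finite.injective_iff_bijective.1 ?_
    rw [Fin.snoc_injective_iff]
    refine ⟨q.1.succAbove_right_injective.comp q.2.injective, ?_⟩
    rintro ⟨i, hi⟩
    exact Fin.succAbove_ne _ _ hi

theorem coe_snocPerm {n : ℕ} (q : Fin (n + 1) × Equiv.Perm (Fin n)) :
    (snocPerm q : Fin (n + 1) → Fin (n + 1)) = Fin.snoc (q.1.succAbove ∘ q.2) q.1 := rfl

theorem snocPerm_bijective {n : ℕ} : Function.Bijective (snocPerm (n := n)) := by
  rw [Fintype.bijective_iff_injective_and_card]
  constructor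
  · rintro ⟨p, τ⟩ ⟨p', τ'⟩ h
    have h' := congrArg (fun σ : Equiv.Perm (Fin (n + 1)) => (σ : Fin (n + 1) → Fin (n + 1))) h
    simp only [coe_snocPerm] at h'
    obtain ⟨h1, rfl⟩ := Fin.snoc_injective2 h'
    refine Prod.ext rfl (Equiv.ext fun i => ?_)
    exact p.succAbove_right_injective (congrFun h1 i)
  · simp [Fintype.card_perm, Nat.factorial_succ]

theorem exceeding_snocPerm_le_iff {n : ℕ} (q : Fin (n + 1) × Equiv.Perm (Fin n)) (t : ℕ) :
    (∀ i, exceeding (snocPerm q) i ≤ t) ↔ n - q.1 ≤ t ∧ ∀ i, exceeding q.2 i ≤ t := by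
  have hlast : exceeding (snocPerm q) n = n - q.1 := by
    rw [exceeding_perm_last, coe_snocPerm, Fin.snoc_last]
  have hlt : ∀ i, i < n → exceeding (snocPerm q) i = exceeding q.2 i := fun i hi => by
    rw [coe_snocPerm, exceeding_snoc _ _ hi,
      exceeding_strictMono_comp (Fin.strictMono_succAbove q.1)]
  constructor
  · intro h
    refine ⟨hlast ▸ h n, fun i => ?_⟩
    by_cases hi : i < n
    · exact hlt i hi ▸ h i
    · rw [exceeding_of_le _ (not_lt.1 hi)]
      exact Nat.zero_le _
  · rintro ⟨h1, h2⟩ i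
    rcases lt_trichotomy i n with hi | rfl | hi
    · rw [hlt i hi]
      exact h2 i
    · rwa [hlast]
    · rw [exceeding_of_le _ hi]
      exact Nat.zero_le _

open Classical in
-- A permutation is determined by its last value and the pattern before it. The last value `p`
-- contributes the table entry `n - p` and leaves the earlier entries unchanged, so each new
-- position multiplies the count by the number of admissible values of its entry.
theorem card_exceeding_le (n t : ℕ) :
    #{σ : Equiv.Perm (Fin n) | ∀ i, exceeding σ i ≤ t} = ∏ j ∈ range n, min (j + 1) (t + 1) := by
  induction n with
  | zero =>
    rw [Finset.prod_range_zero, Finset.filter_true_of_mem]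
    · simp
    · intro σ _ i
      rw [exceeding_of_le _ (Nat.zero_le _)]
      exact Nat.zero_le _
  | succ n ih =>
    rw [Finset.prod_range_succ, ← ih]
    have hcard : #{p : Fin (n + 1) | n - (p : ℕ) ≤ t} = min (n + 1) (t + 1) := by
      have : ({p : Fin (n + 1) | n - (p : ℕ) ≤ t} : Finset (Fin (n + 1)))
          = Finset.Ici ⟨n - t, by omega⟩ := by
        ext p
        simp only [Finset.mem_filter, Finset.mem_univ, true_and, Finset.mem_Ici, Fin.le_def]
        omega
      rw [this, Fin.card_Ici]
      simp only
      omega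
    rw [← hcard, mul_comm, ← Finset.card_product]
    symm
    refine Finset.card_equiv (Equiv.ofBijective snocPerm snocPerm_bijective) fun q => ?_
    simp [exceeding_snocPerm_le_iff]

open Classical in
theorem card_exceeding_comp_le {n : ℕ} {x : Fin n → ℝ} (hx : Function.Injective x) (t : ℕ) :
    #{σ : Equiv.Perm (Fin n) | ∀ i, exceeding (x ∘ σ) i ≤ t}
      = ∏ j ∈ range n, min (j + 1) (t + 1) := by
  rw [← card_exceeding_le]
  have hmono : StrictMono (x ∘ Tuple.sort x) :=
    (Tuple.monotone_sort x).strictMono_of_injective (hx.comp (Tuple.sort x).injective)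
  symm
  -- Composing with the sorting permutation makes `x` increasing, and increasing relabellings
  -- preserve the table.
  refine Finset.card_equiv (Equiv.mulLeft (Tuple.sort x)) fun σ => ?_
  simp only [Finset.mem_filter, Finset.mem_univ, true_and, Equiv.coe_mulLeft, Equiv.Perm.coe_mul,
    ← Function.comp_assoc, exceeding_strictMono_comp hmono]

theorem prod_min_eq {n l : ℕ} (h : l ≤ n) :
    ∏ j ∈ range n, min (j + 1) l = l.factorial * l ^ (n - l) := by
  obtain ⟨d, rfl⟩ := Nat.exists_eq_add_of_le h
  rw [Finset.prod_range_add, ← Finset.prod_range_add_one_eq_factorial]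
  congr 1
  · exact Finset.prod_congr rfl fun j hj => min_eq_left (Finset.mem_range.1 hj)
  · rw [Finset.prod_congr rfl (g := fun _ => l) fun j _ => min_eq_right (by omega)]
    simp

/-! ### The exact expected saving -/

/-- The probability that `n - k` passes bring a random permutation into order. -/
noncomputable def sortedProb (n k : ℕ) : ℝ :=
  ((n - k).factorial * (n - k) ^ k : ℕ) / (n.factorial : ℝ)

theorem expectedComparisons_variant {n : ℕ} (x : Fin n → ℝ) :
    expectedComparisons variant x = expectedComparisons optimized x := by
  simp only [expectedComparisons, variant, optimized, variantPasses_eq_optimizedPasses]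

/-- Pass `t + 2` is saved when all table entries are at most `t`, an event of probability
`sortedProb n k` with `k = n - 1 - t`; its cost is `n - 2 - t = k - 1`. The summand `k = 0` is `-1`
and only serves to make the range uniform, whence the leading `1`. -/
theorem expectedComparisons_sub {n : ℕ} (hn : 1 ≤ n) {x : Fin n → ℝ} (hx : Function.Injective x) :
    expectedComparisons plain x - expectedComparisons optimized x =
      1 + ∑ k ∈ range n, ((k : ℝ) - 1) * sortedProb n k := by
  classical
  have hpt : ∀ σ : Equiv.Perm (Fin n), ((plain (x ∘ σ)).comparisons : ℝ)
      - ((optimized (x ∘ σ)).comparisons : ℝ) =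
      ∑ t ∈ range (n - 1), if ∀ i, exceeding (x ∘ σ) i ≤ t then ((n - 2 - t : ℕ) : ℝ) else 0 := by
    intro σ
    have := plainPasses_comparisons_eq n (start (x ∘ σ)) le_rfl fun i hi => exceeding_of_le _ hi
    rw [plain, optimized, this]
    simp only [start, Nat.cast_add, Nat.cast_sum, add_sub_cancel_left]
    exact Finset.sum_congr rfl fun t _ => by
      by_cases h : ∀ i, exceeding (x ∘ σ) i ≤ t <;> simp [h]
  rw [expectedComparisons, expectedComparisons, ← sub_div, ← Finset.sum_sub_distrib]
  simp only [hpt]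
  rw [Finset.sum_comm, Finset.sum_div]
  have hterm : ∀ t ∈ range (n - 1),
      (∑ σ : Equiv.Perm (Fin n), if ∀ i, exceeding (x ∘ σ) i ≤ t then ((n - 2 - t : ℕ) : ℝ) else 0)
        / (n.factorial : ℝ) = ((n - 2 - t : ℕ) : ℝ) * sortedProb n (n - 1 - t) := by
    intro t ht
    have ht := Finset.mem_range.1 ht
    rw [← Finset.sum_filter, Finset.sum_const, card_exceeding_comp_le hx,
      prod_min_eq (by omega), sortedProb, show n - (n - 1 - t) = t + 1 by omega,
      show n - (t + 1) = n - 1 - t by omega, nsmul_eq_mul]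
    ring
  rw [Finset.sum_congr rfl hterm]
  obtain ⟨m, rfl⟩ := Nat.exists_eq_add_of_le' hn
  rw [Finset.sum_range_succ']
  have h0 : sortedProb (m + 1) 0 = 1 := by
    rw [sortedProb]
    simp [Nat.cast_ne_zero.2 (Nat.factorial_ne_zero (m + 1))]
  rw [h0, Nat.add_sub_cancel, ← Finset.sum_range_reflect]
  simp only [Nat.cast_zero, zero_sub, mul_one, add_comm (1 : ℝ), neg_add_cancel_right]
  refine Finset.sum_congr rfl fun k hk => ?_
  have hk := Finset.mem_range.1 hk
  rw [show m + 1 - 2 - (m - 1 - k) = k by omega, show m - (m - 1 - k) = k + 1 by omega]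
  push_cast
  ring

/-! ### Central binomial coefficients and Wallis' product -/

/-- `4 ^ m / centralBinom m` -/
noncomputable def invCentral (m : ℕ) : ℝ := 4 ^ m / (m.centralBinom : ℝ)

theorem invCentral_pos (m : ℕ) : 0 < invCentral m := by
  have := Nat.centralBinom_pos m
  unfold invCentral
  positivity

theorem invCentral_succ (m : ℕ) :
    invCentral (m + 1) = invCentral m * ((2 * m + 2) / (2 * m + 1)) := by
  have h := Nat.succ_mul_centralBinom_succ m
  have h' : ((m : ℝ) + 1) * ((m + 1).centralBinom : ℝ)
      = 2 * (2 * m + 1) * (m.centralBinom : ℝ) := by exact_mod_cast h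
  have h1 : (0 : ℝ) < (m.centralBinom : ℝ) := by exact_mod_cast Nat.centralBinom_pos m
  have h2 : (0 : ℝ) < ((m + 1).centralBinom : ℝ) := by exact_mod_cast Nat.centralBinom_pos (m + 1)
  unfold invCentral
  rw [div_mul_div_comm, div_eq_div_iff h2.ne' (by positivity), pow_succ]
  linear_combination -2 * (4 : ℝ) ^ m * h'

theorem invCentral_sq (m : ℕ) : invCentral m ^ 2 = (2 * m + 1) * Real.Wallis.W m := by
  induction m with
  | zero => simp [invCentral, Real.Wallis.W]
  | succ m ih =>
    rw [invCentral_succ, mul_pow, ih, Real.Wallis.W_succ]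
    push_cast
    field_simp
    ring

theorem tendsto_invCentral_sq_div :
    Tendsto (fun m : ℕ => invCentral m ^ 2 / m) atTop (nhds Real.pi) := by
  have h := Real.Wallis.tendsto_W_nhds_pi_div_two
  have h2 : Tendsto (fun m : ℕ => (2 : ℝ) + 1 / (m : ℝ)) atTop (nhds (2 + 0)) :=
    tendsto_const_nhds.add tendsto_one_div_atTop_nhds_zero_nat
  have h3 := h2.mul h
  rw [show (2 + 0 : ℝ) * (Real.pi / 2) = Real.pi by ring] at h3
  refine h3.congr' ?_
  filter_upwards [eventually_gt_atTop 0] with m hm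
  have : (m : ℝ) ≠ 0 := by positivity
  rw [invCentral_sq]
  field_simp

/-- If `p m ~ m`, and `p (m + 1) / p m` is at most the ratio of the squares of two consecutive
values of `invCentral`, then `invCentral m ^ 2 ≤ π * p m`. -/
theorem invCentral_sq_le {p : ℕ → ℝ} (hp : ∀ m, 1 ≤ m → 0 < p m)
    (hlim : Tendsto (fun m : ℕ => p m / m) atTop (nhds 1))
    (hstep : ∀ m, 1 ≤ m → p (m + 1) * (2 * m + 1) ^ 2 ≤ p m * (2 * m + 2) ^ 2) {m : ℕ}
    (hm : 1 ≤ m) : invCentral m ^ 2 ≤ Real.pi * p m := by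
  -- The quotient by `p` increases and tends to `π`, hence never exceeds `π`.
  have hmono : Monotone fun k : ℕ => invCentral (k + 1) ^ 2 / p (k + 1) := by
    refine monotone_nat_of_le_succ fun k => ?_
    have h1 := hp (k + 1) (by omega)
    have h2 := hp (k + 1 + 1) (by omega)
    have h3 := hstep (k + 1) (by omega)
    rw [div_le_div_iff₀ h1 h2, invCentral_succ (k + 1), mul_pow, div_pow, mul_assoc]
    refine mul_le_mul_of_nonneg_left ?_ (by positivity)
    rw [div_mul_eq_mul_div, le_div_iff₀ (by positivity)]
    linarith
  have hl : Tendsto (fun k : ℕ => invCentral k ^ 2 / p k) atTop (nhds Real.pi) := by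
    have := tendsto_invCentral_sq_div.div hlim one_ne_zero
    rw [div_one] at this
    refine this.congr' ?_
    filter_upwards [eventually_gt_atTop 0] with k hk
    have : (k : ℝ) ≠ 0 := by positivity
    simp only [Pi.div_apply]
    exact div_div_div_cancel_right₀ this _ _
  obtain ⟨k, rfl⟩ := Nat.exists_eq_add_of_le' hm
  have := hmono.ge_of_tendsto ((tendsto_add_atTop_iff_nat 1).2 hl) k
  rwa [div_le_iff₀ (hp _ hm)] at this

theorem le_invCentral_sq {p : ℕ → ℝ} (hp : ∀ m, 1 ≤ m → 0 < p m)
    (hlim : Tendsto (fun m : ℕ => p m / m) atTop (nhds 1))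
    (hstep : ∀ m, 1 ≤ m → p m * (2 * m + 2) ^ 2 ≤ p (m + 1) * (2 * m + 1) ^ 2) {m : ℕ}
    (hm : 1 ≤ m) : Real.pi * p m ≤ invCentral m ^ 2 := by
  have hmono : Antitone fun k : ℕ => invCentral (k + 1) ^ 2 / p (k + 1) := by
    refine antitone_nat_of_succ_le fun k => ?_
    have h1 := hp (k + 1) (by omega)
    have h2 := hp (k + 1 + 1) (by omega)
    have h3 := hstep (k + 1) (by omega)
    rw [div_le_div_iff₀ h2 h1, invCentral_succ (k + 1), mul_pow, div_pow, mul_assoc]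
    refine mul_le_mul_of_nonneg_left ?_ (by positivity)
    rw [div_mul_eq_mul_div, div_le_iff₀ (by positivity)]
    linarith
  have hl : Tendsto (fun k : ℕ => invCentral k ^ 2 / p k) atTop (nhds Real.pi) := by
    have := tendsto_invCentral_sq_div.div hlim one_ne_zero
    rw [div_one] at this
    refine this.congr' ?_
    filter_upwards [eventually_gt_atTop 0] with k hk
    have : (k : ℝ) ≠ 0 := by positivity
    simp only [Pi.div_apply]
    exact div_div_div_cancel_right₀ this _ _
  obtain ⟨k, rfl⟩ := Nat.exists_eq_add_of_le' hm
  have := hmono.le_of_tendsto ((tendsto_add_atTop_iff_nat 1).2 hl) k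
  rwa [le_div_iff₀ (hp _ hm)] at this

/-! ### A calculus of uniform error bounds -/

/-- `f s x = O(s ^ i)` on the domain `D`, uniformly in `x` up to a polynomial factor. Here
`s = 1 / √n` and `x = k / √n`. -/
def Small (D : ℝ → ℝ → Prop) (i : ℕ) (f : ℝ → ℝ → ℝ) : Prop :=
  ∃ C : ℝ, ∃ p : ℕ, 0 ≤ C ∧ ∀ s x, 0 < s → s ≤ 1 / 2 → 0 ≤ x → D s x →
    |f s x| ≤ C * s ^ i * (1 + x) ^ p

namespace Small

variable {D : ℝ → ℝ → Prop} {i j : ℕ} {f g : ℝ → ℝ → ℝ}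

theorem of_le (C : ℝ) (p : ℕ) (hC : 0 ≤ C)
    (h : ∀ s x, 0 < s → s ≤ 1 / 2 → 0 ≤ x → D s x → |f s x| ≤ C * s ^ i * (1 + x) ^ p) :
    Small D i f := ⟨C, p, hC, h⟩

theorem congr (hf : Small D i f)
    (h : ∀ s x, 0 < s → s ≤ 1 / 2 → 0 ≤ x → D s x → g s x = f s x) : Small D i g := by
  obtain ⟨C, p, hC, hb⟩ := hf
  exact ⟨C, p, hC, fun s x h1 h2 h3 h4 => by rw [h s x h1 h2 h3 h4]; exact hb s x h1 h2 h3 h4⟩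

theorem add (hf : Small D i f) (hg : Small D i g) : Small D i fun s x => f s x + g s x := by
  obtain ⟨C, p, hC, hf⟩ := hf
  obtain ⟨C', q, hC', hg⟩ := hg
  refine ⟨C + C', p + q, by positivity, fun s x h1 h2 h3 h4 => ?_⟩
  have h5 : (1 : ℝ) ≤ 1 + x := by linarith
  calc |f s x + g s x| ≤ |f s x| + |g s x| := abs_add_le _ _
    _ ≤ C * s ^ i * (1 + x) ^ p + C' * s ^ i * (1 + x) ^ q :=
        add_le_add (hf s x h1 h2 h3 h4) (hg s x h1 h2 h3 h4)
    _ ≤ C * s ^ i * (1 + x) ^ (p + q) + C' * s ^ i * (1 + x) ^ (p + q) := by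
        gcongr <;> first | exact h5 | omega
    _ = (C + C') * s ^ i * (1 + x) ^ (p + q) := by ring

theorem mul (hf : Small D i f) (hg : Small D j g) :
    Small D (i + j) fun s x => f s x * g s x := by
  obtain ⟨C, p, hC, hf⟩ := hf
  obtain ⟨C', q, hC', hg⟩ := hg
  refine ⟨C * C', p + q, by positivity, fun s x h1 h2 h3 h4 => ?_⟩
  calc |f s x * g s x| = |f s x| * |g s x| := abs_mul _ _
    _ ≤ (C * s ^ i * (1 + x) ^ p) * (C' * s ^ j * (1 + x) ^ q) :=
        mul_le_mul (hf s x h1 h2 h3 h4) (hg s x h1 h2 h3 h4) (abs_nonneg _) (by positivity)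
    _ = C * C' * s ^ (i + j) * (1 + x) ^ (p + q) := by ring

theorem const (c : ℝ) : Small D 0 fun _ _ => c :=
  ⟨|c|, 0, abs_nonneg c, fun s x _ _ _ _ => by simp⟩

theorem const_mul (c : ℝ) (hf : Small D i f) : Small D i fun s x => c * f s x := by
  simpa using (const (D := D) c).mul hf

theorem neg (hf : Small D i f) : Small D i fun s x => -f s x := by
  simpa using hf.const_mul (-1)

theorem sub (hf : Small D i f) (hg : Small D i g) : Small D i fun s x => f s x - g s x := by
  simpa [sub_eq_add_neg] using hf.add hg.neg

theorem pow_s (a : ℕ) : Small D a fun s _ => s ^ a :=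
  ⟨1, 0, zero_le_one, fun s x h1 _ _ _ => by
    rw [abs_of_nonneg (by positivity)]
    simp⟩

theorem pow_x (b : ℕ) : Small D 0 fun _ x => x ^ b :=
  ⟨1, b, zero_le_one, fun s x _ _ h3 _ => by
    rw [abs_of_nonneg (by positivity)]
    simp only [pow_zero, mul_one, one_mul]
    gcongr
    linarith⟩

theorem weaken (hf : Small D i f) (h : j ≤ i) : Small D j f := by
  obtain ⟨C, p, hC, hf⟩ := hf
  refine ⟨C, p, hC, fun s x h1 h2 h3 h4 => (hf s x h1 h2 h3 h4).trans ?_⟩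
  have := pow_le_pow_of_le_one h1.le (by linarith) h
  gcongr

theorem monomial (c : ℝ) (a b : ℕ) : Small D 0 fun s x => c * s ^ a * x ^ b := by
  simpa using ((pow_s (D := D) a).weaken (Nat.zero_le _)).const_mul c |>.mul (pow_x b)

theorem div_s (hf : Small D (i + 1) f) : Small D i fun s x => f s x / s := by
  obtain ⟨C, p, hC, hf⟩ := hf
  refine ⟨C, p, hC, fun s x h1 h2 h3 h4 => ?_⟩
  rw [abs_div, abs_of_pos h1, div_le_iff₀ h1]
  calc _ ≤ _ := hf s x h1 h2 h3 h4
    _ = _ := by ring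

theorem pow (hf : Small D i f) (m : ℕ) : Small D (i * m) fun s x => f s x ^ m := by
  induction m with
  | zero => simpa using const (D := D) 1
  | succ m ih => simpa [pow_succ, Nat.mul_succ] using ih.mul hf

theorem of_abs_le {h : ℝ → ℝ → ℝ} (hf : Small D i f) (c : ℝ) (hc : 0 ≤ c)
    (hle : ∀ s x, 0 < s → s ≤ 1 / 2 → 0 ≤ x → D s x → |h s x| ≤ c * |f s x|) : Small D i h := by
  obtain ⟨C, p, hC, hf⟩ := hf
  refine ⟨c * C, p, by positivity, fun s x h1 h2 h3 h4 => (hle s x h1 h2 h3 h4).trans ?_⟩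
  have := mul_le_mul_of_nonneg_left (hf s x h1 h2 h3 h4) hc
  linarith

/-- The remainder after `m` terms is at most `|f|^(m+1) / (1 - |f|)`, and `|f| ≤ 1/2` turns the
denominator into the factor `2`. -/
theorem log_taylor (hf : Small D i f) (m : ℕ)
    (hle : ∀ s x, 0 < s → s ≤ 1 / 2 → 0 ≤ x → D s x → |f s x| ≤ 1 / 2) :
    Small D (i * (m + 1)) fun s x =>
      ∑ l ∈ range m, f s x ^ (l + 1) / (l + 1) + Real.log (1 - f s x) := by
  refine (hf.pow (m + 1)).of_abs_le 2 zero_le_two fun s x h1 h2 h3 h4 => ?_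
  have h := hle s x h1 h2 h3 h4
  refine (Real.abs_log_sub_add_sum_range_le (by linarith) m).trans ?_
  rw [div_le_iff₀ (by linarith), abs_pow]
  have : 0 ≤ |f s x| ^ (m + 1) := by positivity
  nlinarith

end Small

/-! ### Logarithmic expansion of the ratio -/

/-- The expansion of the logarithm of the ratio of `sortedProb n k` and a central binomial
ratio, at `s = 1 / √n` and `x = k / √n`. -/
noncomputable def logPoly (s x : ℝ) : ℝ :=
    (-1 / 2) * s ^ 1 * x ^ 1 + (-1 / 3) * s ^ 1 * x ^ 3 + (-3 / 8) * s ^ 2 * x ^ 2 +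
    (-11 / 48) * s ^ 2 * x ^ 4 + (1 / 12) * s ^ 3 * x ^ 1 + (-1 / 6) * s ^ 3 * x ^ 3 +
    (-1 / 5) * s ^ 3 * x ^ 5 + (5 / 48) * s ^ 4 * x ^ 2 + (-9 / 64) * s ^ 4 * x ^ 4 +
    (-79 / 480) * s ^ 4 * x ^ 6 + (1 / 12) * s ^ 5 * x ^ 3 + (-1 / 10) * s ^ 5 * x ^ 5 +
    (-1 / 7) * s ^ 5 * x ^ 7

theorem small_log_ratio : Small (fun s x => s * x ≤ 1 / 2) 7 fun s x =>
    ((x + s) / s * Real.log (1 - s ^ 2 / (1 - s * x)) + Real.log (1 + s * (x + s) / 2)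
      - Real.log (1 - s * x / 2)) - (logPoly s (x + s) - logPoly s x) := by
  have hz : Small (fun s x => s * x ≤ 1 / 2) 0 fun s x => 1 / (1 - s * x) := by
    refine .of_le 2 0 zero_le_two fun s x h1 h2 h3 h4 => ?_
    have h4 : s * x ≤ 1 / 2 := h4
    rw [abs_of_nonneg (by apply div_nonneg <;> linarith), div_le_iff₀ (by linarith)]
    simp only [pow_zero]
    linarith
  have hxs : Small (fun s x => s * x ≤ 1 / 2) 0 fun s x => x + s := by
    simpa using (Small.pow_x 1).add ((Small.pow_s 1).weaken (Nat.zero_le _))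
  have hu : Small (fun s x => s * x ≤ 1 / 2) 2 fun s x => s ^ 2 / (1 - s * x) := by
    simpa [div_eq_mul_inv] using (Small.pow_s 2).mul hz
  have ha : Small (fun s x => s * x ≤ 1 / 2) 1 fun s x => -(s * (x + s) / 2) :=
    ((((Small.pow_s 1).mul hxs).const_mul (-1 / 2))).congr fun s x _ _ _ _ => by ring
  have hb : Small (fun s x => s * x ≤ 1 / 2) 1 fun s x => s * x / 2 :=
    ((((Small.pow_s 1).mul (Small.pow_x 1)).const_mul (1 / 2))).congr fun s x _ _ _ _ => by ring
  have h1 := (((hu.log_taylor 3 fun s x h1 h2 h3 h4 => by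
    have h4 : s * x ≤ 1 / 2 := h4
    rw [abs_of_nonneg (by apply div_nonneg <;> nlinarith), div_le_iff₀ (by linarith)]
    nlinarith).div_s).mul hxs)
  have h2 := ha.log_taylor 6 fun s x h1 h2 h3 h4 => by
    have h4 : s * x ≤ 1 / 2 := h4
    rw [abs_neg, abs_of_nonneg (by positivity)]
    nlinarith
  have h3 := hb.log_taylor 6 fun s x h1 h2 h3 h4 => by
    have h4 : s * x ≤ 1 / 2 := h4
    rw [abs_of_nonneg (by positivity)]
    linarith
  -- The tails of the geometric expansions of `z`, `z^2`, `z^3`, `z = 1/(1 - s x)`, left after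
  -- truncation as in `e1`, `e2`, `e3` below.
  have h4 : Small (fun s x => s * x ≤ 1 / 2) 7 fun s x =>
      s ^ 7 * ((x + s) * (x ^ 6 * (1 / (1 - s * x))
        + 1 / 2 * (x ^ 4 * ((1 / (1 - s * x)) ^ 2 + 4 * (1 / (1 - s * x))))
        + 1 / 3 * (x ^ 2 * ((1 / (1 - s * x)) ^ 3 + 2 * (1 / (1 - s * x)) ^ 2
          + 3 * (1 / (1 - s * x)))))) :=
    (Small.pow_s 7).mul (hxs.mul ((((Small.pow_x 6).mul hz).add
      (((Small.pow_x 4).mul ((hz.pow 2).add (hz.const_mul 4))).const_mul (1 / 2))).add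
        (((Small.pow_x 2).mul (((hz.pow 3).add ((hz.pow 2).const_mul 2)).add
          (hz.const_mul 3))).const_mul (1 / 3))))
  -- The explicit monomials of order at least `s^7` that the truncated polynomials leave over.
  have h5 : Small (fun s x => s * x ≤ 1 / 2) 7 fun s x => s ^ 7 * (
    (1 / 4) * s ^ 0 * x ^ 1 + (113 / 48) * s ^ 0 * x ^ 3 + (127 / 64) * s ^ 0 * x ^ 5 +
    (29 / 120) * s ^ 1 * x ^ 0 + (113 / 32) * s ^ 1 * x ^ 2 + (635 / 128) * s ^ 1 * x ^ 4 +
    (243 / 160) * s ^ 2 * x ^ 1 + (475 / 96) * s ^ 2 * x ^ 3 + (13 / 48) * s ^ 3 * x ^ 0 +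
    (379 / 128) * s ^ 3 * x ^ 2 + (63 / 64) * s ^ 4 * x ^ 1 + (377 / 2688) * s ^ 5 * x ^ 0) := by
    refine (Small.pow_s 7).mul (j := 0) ?_
    repeat' apply Small.add
    all_goals exact Small.monomial _ _ _
  refine ((((h1.add h2).sub h3).sub h4).add h5).congr fun s x p1 p2 p3 p4 => ?_
  have p4 : s * x ≤ 1 / 2 := p4
  have hne : 1 - s * x ≠ 0 := by linarith
  have hzu : s ^ 2 / (1 - s * x) = s ^ 2 * (1 / (1 - s * x)) := by ring
  have hzz : (1 / (1 - s * x)) = 1 + s * x * (1 / (1 - s * x)) := by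
    field_simp
    ring
  simp only [Finset.sum_range_succ, Finset.sum_range_zero, zero_add, sub_neg_eq_add]
  rw [hzu]
  generalize Real.log (1 - s ^ 2 * (1 / (1 - s * x))) = L1
  generalize Real.log (1 + s * (x + s) / 2) = L2
  generalize Real.log (1 - s * x / 2) = L3
  generalize 1 / (1 - s * x) = z at hzz ⊢
  have e1 : z = 1 + s * x + (s * x) ^ 2 + (s * x) ^ 3 + (s * x) ^ 4 + (s * x) ^ 5
      + (s * x) ^ 6 * z := by
    linear_combination (1 + s * x + (s * x) ^ 2 + (s * x) ^ 3 + (s * x) ^ 4 + (s * x) ^ 5) * hzz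
  have e2 : z ^ 2 = 1 + 2 * (s * x) + 3 * (s * x) ^ 2 + 4 * (s * x) ^ 3
      + (s * x) ^ 4 * (z ^ 2 + 4 * z) := by
    linear_combination (z * (1 + s * x + (s * x) ^ 2 + (s * x) ^ 3) + 1 + 2 * (s * x)
      + 3 * (s * x) ^ 2 + 4 * (s * x) ^ 3) * hzz
  have e3 : z ^ 3 = 1 + 3 * (s * x) + (s * x) ^ 2 * (z ^ 3 + 2 * z ^ 2 + 3 * z) := by
    linear_combination (z ^ 2 * (1 + s * x) + z * (1 + 2 * (s * x)) + 1 + 3 * (s * x)) * hzz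
  rw [show ((s ^ 2 * z) ^ 1 / ((0 : ℕ) + 1) + (s ^ 2 * z) ^ (1 + 1) / ((1 : ℕ) + 1)
        + (s ^ 2 * z) ^ (2 + 1) / ((2 : ℕ) + 1) + L1) / s * (x + s)
      = (x + s) / s * L1 + (x + s) * (s * z + s ^ 3 * z ^ 2 / 2 + s ^ 5 * z ^ 3 / 3) by
    push_cast
    field_simp
    ring]
  push_cast
  unfold logPoly
  linear_combination -(x + s) * s * e1 - (x + s) * s ^ 3 / 2 * e2 - (x + s) * s ^ 5 / 3 * e3

/-! ### Exponentiating the logarithmic expansion -/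

theorem Small.monomial_le {D : ℝ → ℝ → Prop} {i : ℕ} (c : ℝ) {a : ℕ} (b : ℕ) (h : i ≤ a) :
    Small D i fun s x => c * s ^ a * x ^ b := by
  simpa using (((Small.pow_s (D := D) a).const_mul c).mul (Small.pow_x b)).weaken h

theorem abs_exp_sub_exp_le {a b : ℝ} (ha : a ≤ 0) (hb : b ≤ 0) :
    |Real.exp a - Real.exp b| ≤ |a - b| := by
  wlog h : b ≤ a generalizing a b
  · rw [abs_sub_comm, abs_sub_comm a]
    exact this hb ha (le_of_not_ge h)
  rw [abs_of_nonneg (sub_nonneg.2 (Real.exp_le_exp.2 h)), abs_of_nonneg (sub_nonneg.2 h)]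
  have h1 : Real.exp b = Real.exp a * Real.exp (b - a) := by
    rw [← Real.exp_add]
    congr 1
    ring
  have h2 := Real.add_one_le_exp (b - a)
  have h3 := Real.exp_le_one_iff.2 ha
  have h4 := Real.exp_pos a
  rw [h1]
  nlinarith

/-- For `|t| > 1` the exponential and each of the six Taylor terms are at most `|t|^6`, which gives
the constant 7. The Horner form prepares the layerwise expansion in `small_taylor_sub_ratioPoly`. -/
theorem abs_exp_sub_taylor_le {t : ℝ} (ht : t ≤ 0) :
    |Real.exp t - (1 + t * (1 + t / 2 * (1 + t / 3 * (1 + t / 4 * (1 + t / 5)))))|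
      ≤ 7 * |t ^ 6| := by
  have hsum : ∑ m ∈ range 6, t ^ m / (m.factorial : ℝ)
      = 1 + t * (1 + t / 2 * (1 + t / 3 * (1 + t / 4 * (1 + t / 5)))) := by
    simp only [Finset.sum_range_succ, Finset.sum_range_zero, Nat.factorial]
    push_cast
    ring
  rw [← hsum]
  rcases le_or_gt |t| 1 with h | h
  · have := Real.exp_bound h (n := 6) (by norm_num)
    refine this.trans ?_
    rw [abs_pow]
    have h6 : 0 ≤ |t| ^ 6 := by positivity
    norm_num [Nat.factorial]
    nlinarith
  · have hpow : ∀ m ∈ range 6, |t ^ m / (m.factorial : ℝ)| ≤ |t| ^ 6 := by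
      intro m hm
      have hm := Finset.mem_range.1 hm
      rw [abs_div, abs_pow, Nat.abs_cast]
      refine (div_le_self (by positivity) ?_).trans (pow_le_pow_right₀ h.le (by omega))
      exact_mod_cast Nat.one_le_iff_ne_zero.2 (Nat.factorial_ne_zero m)
    have h1 := (Finset.abs_sum_le_sum_abs (fun m : ℕ => t ^ m / (m.factorial : ℝ)) (range 6)).trans
      (Finset.sum_le_sum hpow)
    have h2 : |Real.exp t| ≤ |t| ^ 6 := by
      rw [abs_of_pos (Real.exp_pos t)]
      exact (Real.exp_le_one_iff.2 ht).trans (one_le_pow₀ h.le)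
    refine (abs_sub _ _).trans ((add_le_add h2 h1).trans ?_)
    rw [abs_pow]
    simp only [Finset.sum_const, Finset.card_range, nsmul_eq_mul]
    push_cast
    linarith

theorem small_logPoly {D : ℝ → ℝ → Prop} : Small D 1 logPoly := by
  unfold logPoly
  repeat' apply Small.add
  all_goals exact Small.monomial_le _ _ (by norm_num)

/-- The three monomials with positive coefficient are dominated by `s x`, `s^2 x^2` and `s x^3`,
whose negative coefficients are larger in absolute value. -/
theorem logPoly_nonpos {s x : ℝ} (h1 : 0 < s) (h2 : s ≤ 1 / 2) (h3 : 0 ≤ x) :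
    logPoly s x ≤ 0 := by
  have e1 : s ^ 3 * x ≤ s * x := by
    have : s ^ 2 ≤ 1 := by nlinarith
    nlinarith [mul_nonneg h1.le h3]
  have e2 : s ^ 4 * x ^ 2 ≤ s ^ 2 * x ^ 2 := by
    have : s ^ 2 ≤ 1 := by nlinarith
    nlinarith [sq_nonneg (s * x)]
  have e3 : s ^ 5 * x ^ 3 ≤ s * x ^ 3 := by
    have : s ^ 4 ≤ 1 := pow_le_one₀ h1.le (by linarith)
    nlinarith [mul_nonneg h1.le (pow_nonneg h3 3)]
  have p1 : 0 ≤ s * x := by positivity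
  have p2 : 0 ≤ s * x ^ 3 := by positivity
  have p3 : 0 ≤ s ^ 2 * x ^ 2 := by positivity
  have p4 : 0 ≤ s ^ 2 * x ^ 4 := by positivity
  have p5 : 0 ≤ s ^ 3 * x ^ 3 := by positivity
  have p6 : 0 ≤ s ^ 3 * x ^ 5 := by positivity
  have p7 : 0 ≤ s ^ 4 * x ^ 4 := by positivity
  have p8 : 0 ≤ s ^ 4 * x ^ 6 := by positivity
  have p9 : 0 ≤ s ^ 5 * x ^ 5 := by positivity
  have p10 : 0 ≤ s ^ 5 * x ^ 7 := by positivity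
  unfold logPoly
  linarith

/-- The expansion of `exp (logPoly s x)`. -/
noncomputable def ratioPoly (s x : ℝ) : ℝ :=
    1 * s ^ 0 * x ^ 0 + (-1 / 2) * s ^ 1 * x ^ 1 + (-1 / 3) * s ^ 1 * x ^ 3 +
    (-1 / 4) * s ^ 2 * x ^ 2 + (-1 / 16) * s ^ 2 * x ^ 4 + (1 / 18) * s ^ 2 * x ^ 6 +
    (1 / 12) * s ^ 3 * x ^ 1 + (-1 / 480) * s ^ 3 * x ^ 5 + (7 / 144) * s ^ 3 * x ^ 7 +
    (-1 / 162) * s ^ 3 * x ^ 9 + (1 / 16) * s ^ 4 * x ^ 2 + (-17 / 288) * s ^ 4 * x ^ 4 +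
    (-7 / 960) * s ^ 4 * x ^ 6 + (941 / 23040) * s ^ 4 * x ^ 8 + (-25 / 2592) * s ^ 4 * x ^ 10 +
    (1 / 1944) * s ^ 4 * x ^ 12 + (1 / 96) * s ^ 5 * x ^ 3 + (-1 / 18) * s ^ 5 * x ^ 5 +
    (271 / 60480) * s ^ 5 * x ^ 7 + (1619 / 46080) * s ^ 5 * x ^ 9 +
    (-2479 / 207360) * s ^ 5 * x ^ 11 + (1 / 864) * s ^ 5 * x ^ 13 + (-1 / 29160) * s ^ 5 * x ^ 15

theorem small_ratioPoly {D : ℝ → ℝ → Prop} : Small D 0 ratioPoly := by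
  unfold ratioPoly
  repeat' apply Small.add
  all_goals exact Small.monomial _ _ _

/-- The Horner brackets are expanded from the inside out. Each multiplication by `logPoly = O(s)`
gains one order, so the innermost bracket is needed only modulo `s^2`, the next modulo `s^3`, and so
on. The inner bracket is treated as an atom, which keeps each polynomial identity to a single
product. -/
theorem small_taylor_sub_ratioPoly {D : ℝ → ℝ → Prop} : Small D 6 fun s x =>
    (1 + logPoly s x * (1 + logPoly s x / 2 * (1 + logPoly s x / 3 * (1 + logPoly s x / 4 *
      (1 + logPoly s x / 5))))) - ratioPoly s x := by
  have hL := small_logPoly (D := D)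
  have h5 : Small D 2 fun s x => (1 + logPoly s x / 5) - (
      1 * s ^ 0 * x ^ 0 + (-1 / 10) * s ^ 1 * x ^ 1 + (-1 / 15) * s ^ 1 * x ^ 3) := by
    have : Small D 2 fun s x => s ^ 2 * (
      (-3 / 40) * s ^ 0 * x ^ 2 + (-11 / 240) * s ^ 0 * x ^ 4 + (1 / 60) * s ^ 1 * x ^ 1 +
      (-1 / 30) * s ^ 1 * x ^ 3 + (-1 / 25) * s ^ 1 * x ^ 5 + (1 / 48) * s ^ 2 * x ^ 2 +
      (-9 / 320) * s ^ 2 * x ^ 4 + (-79 / 2400) * s ^ 2 * x ^ 6 + (1 / 60) * s ^ 3 * x ^ 3 +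
      (-1 / 50) * s ^ 3 * x ^ 5 + (-1 / 35) * s ^ 3 * x ^ 7) := by
      refine (Small.pow_s 2).mul (j := 0) ?_
      repeat' apply Small.add
      all_goals exact Small.monomial _ _ _
    exact this.congr fun s x _ _ _ _ => by unfold logPoly; ring
  have h4 : Small D 3 fun s x => (1 + logPoly s x / 4 * (1 + logPoly s x / 5)) - (
      1 * s ^ 0 * x ^ 0 + (-1 / 8) * s ^ 1 * x ^ 1 + (-1 / 12) * s ^ 1 * x ^ 3 +
      (-13 / 160) * s ^ 2 * x ^ 2 + (-13 / 320) * s ^ 2 * x ^ 4 + (1 / 180) * s ^ 2 * x ^ 6) := by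
    have : Small D 3 fun s x => s ^ 3 * (
      (1 / 48) * s ^ 0 * x ^ 1 + (-31 / 960) * s ^ 0 * x ^ 3 + (-73 / 1920) * s ^ 0 * x ^ 5 +
      (11 / 2880) * s ^ 0 * x ^ 7 + (23 / 960) * s ^ 1 * x ^ 2 + (-373 / 11520) * s ^ 1 * x ^ 4 +
      (-961 / 28800) * s ^ 1 * x ^ 6 + (1 / 300) * s ^ 1 * x ^ 8 + (7 / 384) * s ^ 2 * x ^ 3 +
      (-107 / 4608) * s ^ 2 * x ^ 5 + (-983 / 33600) * s ^ 2 * x ^ 7 +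
      (79 / 28800) * s ^ 2 * x ^ 9 + (-1 / 480) * s ^ 3 * x ^ 4 + (1 / 900) * s ^ 3 * x ^ 6 +
      (11 / 2100) * s ^ 3 * x ^ 8 + (1 / 420) * s ^ 3 * x ^ 10) := by
      refine (Small.pow_s 3).mul (j := 0) ?_
      repeat' apply Small.add
      all_goals exact Small.monomial _ _ _
    refine (((hL.mul h5).const_mul (1 / 4)).add this).congr fun s x _ _ _ _ => ?_
    generalize 1 + logPoly s x / 5 = t
    unfold logPoly
    ring
  have h3 : Small D 4 fun s x => (1 + logPoly s x / 3 * (1 + logPoly s x / 4 *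
      (1 + logPoly s x / 5))) - (
      1 * s ^ 0 * x ^ 0 + (-1 / 6) * s ^ 1 * x ^ 1 + (-1 / 9) * s ^ 1 * x ^ 3 +
      (-5 / 48) * s ^ 2 * x ^ 2 + (-7 / 144) * s ^ 2 * x ^ 4 + (1 / 108) * s ^ 2 * x ^ 6 +
      (1 / 36) * s ^ 3 * x ^ 1 + (-19 / 720) * s ^ 3 * x ^ 3 + (-89 / 2880) * s ^ 3 * x ^ 5 +
      (43 / 4320) * s ^ 3 * x ^ 7 + (-1 / 1620) * s ^ 3 * x ^ 9) := by
    have : Small D 4 fun s x => s ^ 4 * (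
      (1 / 32) * s ^ 0 * x ^ 2 + (-1109 / 34560) * s ^ 0 * x ^ 4 + (-529 / 17280) * s ^ 0 * x ^ 6 +
      (367 / 46080) * s ^ 0 * x ^ 8 + (-11 / 25920) * s ^ 0 * x ^ 10 + (61 / 2880) * s ^ 1 * x ^ 3 +
      (-373 / 13824) * s ^ 1 * x ^ 5 + (-52667 / 1814400) * s ^ 1 * x ^ 7 +
      (1807 / 259200) * s ^ 1 * x ^ 9 + (-1 / 2700) * s ^ 1 * x ^ 11 +
      (-29 / 4608) * s ^ 2 * x ^ 4 + (235 / 55296) * s ^ 2 * x ^ 6 +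
      (887449 / 58060800) * s ^ 2 * x ^ 8 + (6383 / 1075200) * s ^ 2 * x ^ 10 +
      (-79 / 259200) * s ^ 2 * x ^ 12 + (-13 / 5760) * s ^ 3 * x ^ 5 +
      (91 / 57600) * s ^ 3 * x ^ 7 + (9757 / 1814400) * s ^ 3 * x ^ 9 +
      (529 / 302400) * s ^ 3 * x ^ 11 + (-1 / 3780) * s ^ 3 * x ^ 13) := by
      refine (Small.pow_s 4).mul (j := 0) ?_
      repeat' apply Small.add
      all_goals exact Small.monomial _ _ _
    refine (((hL.mul h4).const_mul (1 / 3)).add this).congr fun s x _ _ _ _ => ?_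
    generalize 1 + logPoly s x / 4 * (1 + logPoly s x / 5) = t
    unfold logPoly
    ring
  have h2 : Small D 5 fun s x => (1 + logPoly s x / 2 * (1 + logPoly s x / 3 *
      (1 + logPoly s x / 4 * (1 + logPoly s x / 5)))) - (
      1 * s ^ 0 * x ^ 0 + (-1 / 4) * s ^ 1 * x ^ 1 + (-1 / 6) * s ^ 1 * x ^ 3 +
      (-7 / 48) * s ^ 2 * x ^ 2 + (-17 / 288) * s ^ 2 * x ^ 4 + (1 / 54) * s ^ 2 * x ^ 6 +
      (1 / 24) * s ^ 3 * x ^ 1 + (-5 / 192) * s ^ 3 * x ^ 3 + (-11 / 360) * s ^ 3 * x ^ 5 +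
      (1 / 54) * s ^ 3 * x ^ 7 + (-1 / 648) * s ^ 3 * x ^ 9 + (11 / 288) * s ^ 4 * x ^ 2 +
      (-1367 / 34560) * s ^ 4 * x ^ 4 + (-1603 / 69120) * s ^ 4 * x ^ 6 +
      (1217 / 69120) * s ^ 4 * x ^ 8 + (-133 / 51840) * s ^ 4 * x ^ 10 +
      (1 / 9720) * s ^ 4 * x ^ 12) := by
    have : Small D 5 fun s x => s ^ 5 * (
      (3 / 128) * s ^ 0 * x ^ 3 + (-77 / 2160) * s ^ 0 * x ^ 5 + (-15229 / 580608) * s ^ 0 * x ^ 7 +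
      (2473 / 165888) * s ^ 0 * x ^ 9 + (-809 / 414720) * s ^ 0 * x ^ 11 +
      (11 / 155520) * s ^ 0 * x ^ 13 + (1 / 864) * s ^ 1 * x ^ 2 + (-1091 / 69120) * s ^ 1 * x ^ 4 +
      (611 / 92160) * s ^ 1 * x ^ 6 + (114707 / 3225600) * s ^ 1 * x ^ 8 +
      (588773 / 43545600) * s ^ 1 * x ^ 10 + (-2653 / 1555200) * s ^ 1 * x ^ 12 +
      (1 / 16200) * s ^ 1 * x ^ 14 + (5 / 3456) * s ^ 2 * x ^ 3 + (-53 / 6912) * s ^ 2 * x ^ 5 +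
      (79 / 69120) * s ^ 2 * x ^ 7 + (585241 / 38707200) * s ^ 2 * x ^ 9 +
      (14993 / 3110400) * s ^ 2 * x ^ 11 + (-41719 / 29030400) * s ^ 2 * x ^ 13 +
      (79 / 1555200) * s ^ 2 * x ^ 15 + (1 / 864) * s ^ 3 * x ^ 4 + (-43 / 17280) * s ^ 3 * x ^ 6 +
      (-4723 / 2419200) * s ^ 3 * x ^ 8 + (109 / 28350) * s ^ 3 * x ^ 10 +
      (4583 / 2721600) * s ^ 3 * x ^ 12 + (-617 / 907200) * s ^ 3 * x ^ 14 +
      (1 / 22680) * s ^ 3 * x ^ 16) := by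
      refine (Small.pow_s 5).mul (j := 0) ?_
      repeat' apply Small.add
      all_goals exact Small.monomial _ _ _
    refine (((hL.mul h3).const_mul (1 / 2)).add this).congr fun s x _ _ _ _ => ?_
    generalize 1 + logPoly s x / 3 * (1 + logPoly s x / 4 * (1 + logPoly s x / 5)) = t
    unfold logPoly
    ring
  have : Small D 6 fun s x => s ^ 6 * (
      (1 / 288) * s ^ 0 * x ^ 2 + (-137 / 2304) * s ^ 0 * x ^ 4 + (461 / 18432) * s ^ 0 * x ^ 6 +
      (674771 / 5806080) * s ^ 0 * x ^ 8 + (11331791 / 348364800) * s ^ 0 * x ^ 10 +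
      (-19045 / 1990656) * s ^ 0 * x ^ 12 + (427 / 497664) * s ^ 0 * x ^ 14 +
      (-11 / 466560) * s ^ 0 * x ^ 16 + (13 / 1728) * s ^ 1 * x ^ 3 +
      (-6301 / 207360) * s ^ 1 * x ^ 5 + (509 / 1658880) * s ^ 1 * x ^ 7 +
      (107899 / 2073600) * s ^ 1 * x ^ 9 + (450031 / 43545600) * s ^ 1 * x ^ 11 +
      (-139807 / 16329600) * s ^ 1 * x ^ 13 + (3499 / 4665600) * s ^ 1 * x ^ 15 +
      (-1 / 48600) * s ^ 1 * x ^ 17 + (103 / 13824) * s ^ 2 * x ^ 4 +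
      (-26257 / 1658880) * s ^ 2 * x ^ 6 + (-419623 / 46448640) * s ^ 2 * x ^ 8 +
      (9254603 / 464486400) * s ^ 2 * x ^ 10 + (4819039 / 1393459200) * s ^ 2 * x ^ 12 +
      (-10487539 / 2090188800) * s ^ 2 * x ^ 14 + (109429 / 174182400) * s ^ 2 * x ^ 16 +
      (-79 / 4665600) * s ^ 2 * x ^ 18 + (11 / 3456) * s ^ 3 * x ^ 5 +
      (-2951 / 414720) * s ^ 3 * x ^ 7 + (-99677 / 29030400) * s ^ 3 * x ^ 9 +
      (273961 / 29030400) * s ^ 3 * x ^ 11 + (8327 / 6220800) * s ^ 3 * x ^ 13 +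
      (-146977 / 65318400) * s ^ 3 * x ^ 15 + (277 / 777600) * s ^ 3 * x ^ 17 +
      (-1 / 68040) * s ^ 3 * x ^ 19) := by
    refine (Small.pow_s 6).mul (j := 0) ?_
    repeat' apply Small.add
    all_goals exact Small.monomial _ _ _
  refine ((hL.mul h2).add this).congr fun s x _ _ _ _ => ?_
  generalize 1 + logPoly s x / 2 * (1 + logPoly s x / 3 * (1 + logPoly s x / 4 *
    (1 + logPoly s x / 5))) = t
  unfold logPoly ratioPoly
  ring

theorem small_exp_logPoly_sub_ratioPoly {D : ℝ → ℝ → Prop} :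
    Small D 6 fun s x => Real.exp (logPoly s x) - ratioPoly s x := by
  have h : Small D 6 fun s x => Real.exp (logPoly s x) - (1 + logPoly s x * (1 + logPoly s x / 2 *
      (1 + logPoly s x / 3 * (1 + logPoly s x / 4 * (1 + logPoly s x / 5))))) :=
    (small_logPoly.pow 6).of_abs_le 7 (by norm_num) fun s x h1 h2 h3 _ =>
      abs_exp_sub_taylor_le (logPoly_nonpos h1 h2 h3)
  exact (h.add small_taylor_sub_ratioPoly).congr fun s x _ _ _ _ => by ring

/-! ### A discrete antiderivative -/

/-- A polynomial whose weighted differences sum the first moment of `sortedProb`. -/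
noncomputable def summationPoly (s x : ℝ) : ℝ :=
    (1 / 2) * s ^ 0 * x ^ 0 + (-3 / 4) * s ^ 1 * x ^ 1 + (-1 / 6) * s ^ 1 * x ^ 3 +
    (43 / 24) * s ^ 2 * x ^ 0 + (5 / 6) * s ^ 2 * x ^ 2 + (13 / 96) * s ^ 2 * x ^ 4 +
    (1 / 36) * s ^ 2 * x ^ 6 + (-215 / 192) * s ^ 3 * x ^ 1 + (-97 / 192) * s ^ 3 * x ^ 3 +
    (-131 / 960) * s ^ 3 * x ^ 5 + (-1 / 288) * s ^ 3 * x ^ 7 + (-1 / 324) * s ^ 3 * x ^ 9 +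
    (3659 / 17280) * s ^ 4 * x ^ 0 + (8647 / 17280) * s ^ 4 * x ^ 2 +
    (4003 / 17280) * s ^ 4 * x ^ 4 + (173 / 5184) * s ^ 4 * x ^ 6 +
    (8309 / 414720) * s ^ 4 * x ^ 8 + (-1 / 576) * s ^ 4 * x ^ 10 + (1 / 3888) * s ^ 4 * x ^ 12 +
    (-6787 / 276480) * s ^ 5 * x ^ 1 + (-38881 / 276480) * s ^ 5 * x ^ 3 +
    (-203 / 2048) * s ^ 5 * x ^ 5 + (-259663 / 5806080) * s ^ 5 * x ^ 7 +
    (21059 / 2488320) * s ^ 5 * x ^ 9 + (-4477 / 1244160) * s ^ 5 * x ^ 11 +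
    (5 / 15552) * s ^ 5 * x ^ 13 + (-1 / 58320) * s ^ 5 * x ^ 15

/-- With `2 / s^2 = 2n` and `x / s = k`, the first bracket is the expression summed in
`sum_centralRatio_mul_sub` for `m = 2n`. To leading order it is `2 (x P - P') / s`. Polynomials `x P
- P'` together with the constants span all polynomials, so `P = summationPoly` can be solved for
order by order, leaving only the constants in `s`. -/
theorem small_summationPoly {D : ℝ → ℝ → Prop} : Small D 5 fun s x =>
    (summationPoly s x * (2 / s ^ 2 + x / s) - summationPoly s (x + s) * (2 / s ^ 2 - x / s))
      + (-5 / 2 - 29 / 32 * s ^ 2 + 1955 / 9216 * s ^ 4) - (x / s - 1) * ratioPoly s x := by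
  have : Small D 5 fun s x => s ^ 5 * (
    (35347 / 276480) * s ^ 0 * x ^ 1 + (152807 / 165888) * s ^ 0 * x ^ 3 +
    (199127 / 829440) * s ^ 0 * x ^ 5 + (-42907 / 215040) * s ^ 0 * x ^ 7 +
    (785897 / 2488320) * s ^ 0 * x ^ 9 + (-105401 / 1244160) * s ^ 0 * x ^ 11 +
    (139 / 15552) * s ^ 0 * x ^ 13 + (-17 / 58320) * s ^ 0 * x ^ 15 +
    (1627 / 46080) * s ^ 1 * x ^ 0 + (308609 / 276480) * s ^ 1 * x ^ 2 +
    (4549 / 6912) * s ^ 1 * x ^ 4 + (-149089 / 165888) * s ^ 1 * x ^ 6 +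
    (53353 / 51840) * s ^ 1 * x ^ 8 + (-80927 / 248832) * s ^ 1 * x ^ 10 +
    (949 / 23328) * s ^ 1 * x ^ 12 + (-7 / 3888) * s ^ 1 * x ^ 14 +
    (171889 / 276480) * s ^ 2 * x ^ 1 + (14543 / 17280) * s ^ 2 * x ^ 3 +
    (-1500811 / 829440) * s ^ 2 * x ^ 5 + (479803 / 207360) * s ^ 2 * x ^ 7 +
    (-230461 / 248832) * s ^ 2 * x ^ 9 + (1079 / 7776) * s ^ 2 * x ^ 11 +
    (-91 / 11664) * s ^ 2 * x ^ 13 + (11483 / 82944) * s ^ 3 * x ^ 0 +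
    (109307 / 165888) * s ^ 3 * x ^ 2 + (-582301 / 276480) * s ^ 3 * x ^ 4 +
    (96173 / 27648) * s ^ 3 * x ^ 6 + (-75119 / 41472) * s ^ 3 * x ^ 8 +
    (25883 / 77760) * s ^ 3 * x ^ 10 + (-91 / 3888) * s ^ 3 * x ^ 12 +
    (80701 / 276480) * s ^ 4 * x ^ 1 + (-413183 / 276480) * s ^ 4 * x ^ 3 +
    (300199 / 82944) * s ^ 4 * x ^ 5 + (-524249 / 207360) * s ^ 4 * x ^ 7 +
    (27313 / 46656) * s ^ 4 * x ^ 9 + (-1001 / 19440) * s ^ 4 * x ^ 11 +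
    (161257 / 2903040) * s ^ 5 * x ^ 0 + (-105115 / 165888) * s ^ 5 * x ^ 2 +
    (543883 / 207360) * s ^ 5 * x ^ 4 + (-531289 / 207360) * s ^ 5 * x ^ 6 +
    (1001 / 1296) * s ^ 5 * x ^ 8 + (-1001 / 11664) * s ^ 5 * x ^ 10 +
    (-168827 / 1161216) * s ^ 6 * x ^ 1 + (202309 / 155520) * s ^ 6 * x ^ 3 +
    (-78287 / 41472) * s ^ 6 * x ^ 5 + (1001 / 1296) * s ^ 6 * x ^ 7 +
    (-143 / 1296) * s ^ 6 * x ^ 9 + (-16739 / 1244160) * s ^ 7 * x ^ 0 +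
    (1046791 / 2488320) * s ^ 7 * x ^ 2 + (-82687 / 82944) * s ^ 7 * x ^ 4 +
    (27313 / 46656) * s ^ 7 * x ^ 6 + (-143 / 1296) * s ^ 7 * x ^ 8 +
    (198367 / 2488320) * s ^ 8 * x ^ 1 + (-10087 / 27648) * s ^ 8 * x ^ 3 +
    (25883 / 77760) * s ^ 8 * x ^ 5 + (-1001 / 11664) * s ^ 8 * x ^ 7 +
    (4157 / 622080) * s ^ 9 * x ^ 0 + (-107807 / 1244160) * s ^ 9 * x ^ 2 +
    (1079 / 7776) * s ^ 9 * x ^ 4 + (-1001 / 19440) * s ^ 9 * x ^ 6 +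
    (-14557 / 1244160) * s ^ 10 * x ^ 1 + (949 / 23328) * s ^ 10 * x ^ 3 +
    (-91 / 3888) * s ^ 10 * x ^ 5 + (-5 / 7776) * s ^ 11 * x ^ 0 + (121 / 15552) * s ^ 11 * x ^ 2 +
    (-91 / 11664) * s ^ 11 * x ^ 4 + (13 / 15552) * s ^ 12 * x ^ 1 + (-7 / 3888) * s ^ 12 * x ^ 3 +
    (1 / 29160) * s ^ 13 * x ^ 0 + (-1 / 3888) * s ^ 13 * x ^ 2 + (-1 / 58320) * s ^ 14 * x ^ 1) := by
    refine (Small.pow_s 5).mul (j := 0) ?_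
    repeat' apply Small.add
    all_goals exact Small.monomial _ _ _
  refine this.congr fun s x h1 _ _ _ => ?_
  have hs : s ≠ 0 := h1.ne'
  rw [← mul_left_inj' (pow_ne_zero 2 hs)]
  rw [show ∀ a b c R : ℝ, ((a * (2 / s ^ 2 + x / s) - b * (2 / s ^ 2 - x / s)) + c
      - (x / s - 1) * R) * s ^ 2
      = a * (2 + s * x) - b * (2 - s * x) + c * s ^ 2 - (s * x - s ^ 2) * R by
    intro a b c R
    field_simp]
  unfold summationPoly ratioPoly
  ring

/-! ### Exact recurrences and Gaussian bounds -/

theorem sortedProb_zero (n : ℕ) : sortedProb n 0 = 1 := by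
  rw [sortedProb]
  simp [Nat.cast_ne_zero.2 (Nat.factorial_ne_zero n)]

theorem sortedProb_pos {n k : ℕ} (h : k < n) : 0 < sortedProb n k := by
  have h1 : 0 < (n - k).factorial * (n - k) ^ k :=
    Nat.mul_pos (Nat.factorial_pos _) (Nat.pow_pos (by omega))
  have h2 : (0 : ℝ) < (((n - k).factorial * (n - k) ^ k : ℕ) : ℝ) := by exact_mod_cast h1
  have h3 : (0 : ℝ) < n.factorial := by exact_mod_cast Nat.factorial_pos n
  exact div_pos h2 h3

theorem sortedProb_eq_zero {n k : ℕ} (hn : 1 ≤ n) (h : n ≤ k) : sortedProb n k = 0 := by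
  rw [sortedProb, Nat.sub_eq_zero_of_le h, zero_pow (by omega)]
  simp

theorem sortedProb_succ {n k : ℕ} (h : k < n) :
    sortedProb n (k + 1) = sortedProb n k * (1 - 1 / ((n : ℝ) - k)) ^ (k + 1) := by
  obtain ⟨d, rfl⟩ := Nat.exists_eq_add_of_lt h
  rw [sortedProb, sortedProb, show k + d + 1 - (k + 1) = d by omega,
    show k + d + 1 - k = d + 1 by omega, Nat.factorial_succ d]
  have hd : (0 : ℝ) < (d : ℝ) + 1 := by positivity
  push_cast
  rw [show (1 : ℝ) - 1 / ((k : ℝ) + d + 1 - k) = d / (d + 1) by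
    rw [show (k : ℝ) + d + 1 - k = d + 1 by ring]
    field_simp
    ring, div_pow, pow_succ ((d : ℝ) + 1)]
  field_simp

/-- The ratio of a binomial coefficient to the central one. -/
noncomputable def centralRatio (m k : ℕ) : ℝ :=
  ((2 * m).choose (m + k) : ℝ) / (m.centralBinom : ℝ)

theorem centralRatio_zero (m : ℕ) : centralRatio m 0 = 1 := by
  rw [centralRatio, add_zero, ← Nat.centralBinom_eq_two_mul_choose]
  exact div_self (Nat.cast_ne_zero.2 (Nat.centralBinom_ne_zero m))

theorem centralRatio_nonneg (m k : ℕ) : 0 ≤ centralRatio m k := by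
  unfold centralRatio
  positivity

theorem centralRatio_pos {m k : ℕ} (h : k ≤ m) : 0 < centralRatio m k := by
  unfold centralRatio
  have h1 : (0 : ℝ) < (2 * m).choose (m + k) := by exact_mod_cast Nat.choose_pos (by omega)
  have h2 : (0 : ℝ) < m.centralBinom := by exact_mod_cast Nat.centralBinom_pos m
  positivity

theorem centralRatio_eq_zero {m k : ℕ} (h : m < k) : centralRatio m k = 0 := by
  rw [centralRatio, Nat.choose_eq_zero_of_lt (by omega)]
  simp

theorem centralRatio_succ_mul {m k : ℕ} (h : k ≤ m) :
    centralRatio m (k + 1) * (m + k + 1) = centralRatio m k * (m - k) := by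
  have h1 := Nat.choose_succ_right_eq (2 * m) (m + k)
  rw [show 2 * m - (m + k) = m - k by omega] at h1
  have h2 : ((2 * m).choose (m + k + 1) : ℝ) * (m + k + 1)
      = ((2 * m).choose (m + k) : ℝ) * (m - k) := by
    rw [← Nat.cast_sub h]
    exact_mod_cast h1
  rw [centralRatio, centralRatio, div_mul_eq_mul_div, div_mul_eq_mul_div, ← h2]
  rfl

/-- By symmetry, the upper half of the row `2m` of Pascal's triangle with its middle term is half of
`4^m` plus the central coefficient. -/
theorem sum_centralRatio (m : ℕ) :
    ∑ k ∈ range (m + 1), centralRatio m k = (invCentral m + 1) / 2 := by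
  have h1 : ∑ i ∈ range (2 * m + 1), ((2 * m).choose i : ℝ) = 4 ^ m := by
    have := Nat.sum_range_choose (2 * m)
    rw [pow_mul] at this
    exact_mod_cast this
  have h2 : ∑ i ∈ range m, ((2 * m).choose i : ℝ)
      = ∑ k ∈ range m, ((2 * m).choose (m + (k + 1)) : ℝ) := by
    rw [← Finset.sum_range_reflect]
    refine Finset.sum_congr rfl fun k hk => ?_
    have hk := Finset.mem_range.1 hk
    rw [← Nat.choose_symm (by omega : m + (k + 1) ≤ 2 * m)]
    congr 2
    omega
  rw [show 2 * m + 1 = m + (m + 1) by ring, Finset.sum_range_add, h2] at h1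
  have h3 : (0 : ℝ) < m.centralBinom := by exact_mod_cast Nat.centralBinom_pos m
  rw [Finset.sum_range_succ'] at h1
  simp only [centralRatio]
  rw [← Finset.sum_div, Finset.sum_range_succ', invCentral, ← h1, add_zero,
    ← Nat.centralBinom_eq_two_mul_choose]
  field_simp
  ring

theorem centralRatio_le_exp {m k : ℕ} (h : k ≤ m) :
    centralRatio m k ≤ Real.exp (-((k : ℝ) ^ 2 / (2 * m))) := by
  induction k with
  | zero => simp [centralRatio_zero]
  | succ k ih =>
    have hk : (k : ℝ) + 1 ≤ m := by exact_mod_cast h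
    have hm : (0 : ℝ) < m := by
      have : (0 : ℝ) ≤ k := k.cast_nonneg
      linarith
    have h1 := centralRatio_succ_mul (by omega : k ≤ m)
    have h2 : centralRatio m (k + 1) = centralRatio m k * ((m - k) / (m + k + 1)) := by
      rw [mul_div_assoc', eq_div_iff (by positivity), h1]
    have h3 : ((m : ℝ) - k) / (m + k + 1) ≤ Real.exp (-((2 * k + 1) / (2 * m))) := by
      refine le_trans ?_ (Real.one_sub_le_exp_neg _)
      rw [div_le_iff₀ (by positivity), ← sub_nonneg]
      rw [show (1 - (2 * (k : ℝ) + 1) / (2 * m)) * (m + k + 1) - (m - k)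
        = (2 * k + 1) * (m - k - 1) / (2 * m) by
          field_simp
          ring]
      apply div_nonneg _ (by positivity)
      apply mul_nonneg (by positivity)
      linarith
    rw [h2, show -(((k + 1 : ℕ) : ℝ) ^ 2 / (2 * m))
      = -((k : ℝ) ^ 2 / (2 * m)) + -((2 * k + 1) / (2 * m)) by
        push_cast
        field_simp
        ring, Real.exp_add]
    exact mul_le_mul (ih (by omega)) h3 (div_nonneg (by linarith) (by positivity))
      (Real.exp_pos _).le

/-- Summation by parts against the central binomial ratios. -/
theorem sum_centralRatio_mul_sub (m : ℕ) (g : ℕ → ℝ) :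
    ∑ k ∈ range (m + 1), centralRatio m k * (g k * (m + k) - g (k + 1) * (m - k)) = m * g 0 := by
  have h : ∀ k ∈ range (m + 1), centralRatio m k * (g k * (m + k) - g (k + 1) * (m - k))
      = g k * (m + k) * centralRatio m k
        - g (k + 1) * (m + (k + 1 : ℕ)) * centralRatio m (k + 1) := by
    intro k hk
    have := centralRatio_succ_mul (Nat.lt_succ_iff.1 (Finset.mem_range.1 hk))
    push_cast
    linear_combination g (k + 1) * this
  rw [Finset.sum_congr rfl h, Finset.sum_range_sub', centralRatio_eq_zero (Nat.lt_succ_self m),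
    centralRatio_zero]
  simp
  ring

theorem sum_one_div_sq_le {s : ℝ} (hs : 0 < s) (N : ℕ) :
    ∑ k ∈ range (N + 1), 1 / (1 + k * s) ^ 2 ≤ 1 + 1 / s * (1 - 1 / (1 + N * s)) := by
  induction N with
  | zero => simp
  | succ N ih =>
    rw [Finset.sum_range_succ]
    have h1 : (0 : ℝ) < 1 + N * s := by positivity
    have h2 : 1 / (1 + ((N + 1 : ℕ) : ℝ) * s) ^ 2
        ≤ 1 / s * (1 / (1 + N * s) - 1 / (1 + ((N + 1 : ℕ) : ℝ) * s)) := by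
      push_cast
      have h3 : (0 : ℝ) < 1 + (N + 1) * s := by positivity
      rw [show 1 / s * (1 / (1 + N * s) - 1 / (1 + ((N : ℝ) + 1) * s))
        = 1 / ((1 + N * s) * (1 + (N + 1) * s)) by
          field_simp
          ring]
      apply one_div_le_one_div_of_le (by positivity)
      rw [pow_two]
      apply mul_le_mul_of_nonneg_right _ h3.le
      linarith
    linarith

theorem one_add_pow_mul_exp_le (p : ℕ) {x : ℝ} (hx : 0 ≤ x) :
    (1 + x) ^ p * Real.exp (-(x ^ 2 / 4)) ≤ 8 ^ p * p.factorial * Real.exp (1 / 4) := by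
  have h1 : (1 + x) ^ p ≤ (8 * ((1 + x ^ 2) / 4)) ^ p := by
    apply pow_le_pow_left₀ (by positivity)
    nlinarith [sq_nonneg (2 * x - 1 / 2)]
  have h2 := Real.pow_div_factorial_le_exp ((1 + x ^ 2) / 4) (by positivity) p
  have h3 : (0 : ℝ) < p.factorial := by exact_mod_cast Nat.factorial_pos p
  rw [div_le_iff₀ h3] at h2
  have h4 : Real.exp ((1 + x ^ 2) / 4) * Real.exp (-(x ^ 2 / 4)) = Real.exp (1 / 4) := by
    rw [← Real.exp_add]
    congr 1
    ring
  calc (1 + x) ^ p * Real.exp (-(x ^ 2 / 4))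
      ≤ 8 ^ p * (Real.exp ((1 + x ^ 2) / 4) * p.factorial) * Real.exp (-(x ^ 2 / 4)) := by
        rw [mul_pow] at h1
        apply mul_le_mul_of_nonneg_right (h1.trans _) (Real.exp_pos _).le
        gcongr
    _ = 8 ^ p * p.factorial * Real.exp (1 / 4) := by
        rw [← h4]
        ring

/-- The Gaussian bound absorbs the power `p + 2` of `1 + k s`; the two spare factors leave `∑ 1/(1 +
k s)^2`, which telescopes to `O(1/s)`. This is the cost of passing from a termwise error to a sum.
-/
theorem sum_centralRatio_mul_pow_le (p : ℕ) : ∃ K : ℝ, 0 ≤ K ∧ ∀ n : ℕ, ∀ s : ℝ, 0 < s → s ≤ 1 →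
    s ^ 2 * n = 1 →
    ∑ k ∈ range (2 * n + 1), centralRatio (2 * n) k * (1 + k * s) ^ p ≤ K / s := by
  refine ⟨2 * (8 ^ (p + 2) * (p + 2).factorial * Real.exp (1 / 4)), by positivity,
    fun n s hs hs1 hn => ?_⟩
  set M : ℝ := 8 ^ (p + 2) * (p + 2).factorial * Real.exp (1 / 4) with hM
  have hM0 : 0 ≤ M := by positivity
  have hterm : ∀ k ∈ range (2 * n + 1), centralRatio (2 * n) k * (1 + k * s) ^ p
      ≤ M * (1 / (1 + k * s) ^ 2) := by
    intro k hk
    have h1 := centralRatio_le_exp (Nat.lt_succ_iff.1 (Finset.mem_range.1 hk))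
    have h2 := one_add_pow_mul_exp_le (p + 2) (x := k * s) (by positivity)
    have hn0 : (n : ℝ) ≠ 0 := fun h => by simp [h] at hn
    have h3 : (k : ℝ) ^ 2 / (2 * ((2 * n : ℕ) : ℝ)) = (k * s) ^ 2 / 4 := by
      push_cast
      field_simp
      linear_combination -(4 * (k : ℝ) ^ 2) * hn
    rw [h3] at h1
    rw [mul_one_div, le_div_iff₀ (by positivity)]
    calc centralRatio (2 * n) k * (1 + k * s) ^ p * (1 + k * s) ^ 2
        = (1 + k * s) ^ (p + 2) * centralRatio (2 * n) k := by ring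
      _ ≤ (1 + k * s) ^ (p + 2) * Real.exp (-((k * s) ^ 2 / 4)) := by gcongr
      _ ≤ M := h2
  refine (Finset.sum_le_sum hterm).trans ?_
  rw [← Finset.mul_sum]
  have h4 := sum_one_div_sq_le hs (2 * n)
  have h5 : 1 + 1 / s * (1 - 1 / (1 + ((2 * n : ℕ) : ℝ) * s)) ≤ 2 / s := by
    have h6 : 1 ≤ 1 / s := by rw [le_div_iff₀ hs]; linarith
    have h7 : 0 ≤ 1 / (1 + ((2 * n : ℕ) : ℝ) * s) := by positivity
    have h8 : 2 / s = 1 / s + 1 / s := by ring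
    nlinarith
  calc M * _ ≤ M * (2 / s) := mul_le_mul_of_nonneg_left (h4.trans h5) hM0
    _ = 2 * M / s := by ring

/-- Compared ratio by ratio: one step multiplies `w` by at most `exp (-(k+1)/(n-k))`, while the
inverse step of `v` is at most `1 + (k+1)/(n-k)`. -/
theorem sortedProb_le_centralRatio {n k : ℕ} (h : k < n) :
    sortedProb n k ≤ centralRatio (2 * n) k := by
  induction k with
  | zero => rw [sortedProb_zero, centralRatio_zero]
  | succ k ih =>
    have hk : (k : ℝ) + 1 < n := by exact_mod_cast h
    have hk0 : (0 : ℝ) ≤ k := k.cast_nonneg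
    have h1 := centralRatio_succ_mul (by omega : k ≤ 2 * n)
    push_cast at h1
    have hd : (0 : ℝ) < (n : ℝ) - k := by linarith
    have h2n : (0 : ℝ) < 2 * (n : ℝ) - k := by linarith
    have hρ : (1 - 1 / ((n : ℝ) - k)) ^ (k + 1) ≤ Real.exp (-((k + 1) / (n - k))) := by
      have h0 : 0 ≤ 1 - 1 / ((n : ℝ) - k) := by
        rw [sub_nonneg, div_le_one hd]
        linarith
      calc (1 - 1 / ((n : ℝ) - k)) ^ (k + 1)
          ≤ Real.exp (-(1 / ((n : ℝ) - k))) ^ (k + 1) :=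
            pow_le_pow_left₀ h0 (Real.one_sub_le_exp_neg _) _
        _ = Real.exp (-((k + 1) / (n - k))) := by
            rw [← Real.exp_nat_mul]
            congr 1
            push_cast
            ring
    have hτ : (2 * (n : ℝ) + k + 1) / (2 * n - k) ≤ Real.exp ((k + 1) / (n - k)) := by
      have h3 : (2 * (n : ℝ) + k + 1) / (2 * n - k) ≤ (k + 1) / (n - k) + 1 := by
        rw [div_add_one hd.ne', div_le_div_iff₀ h2n hd]
        nlinarith
      exact h3.trans (Real.add_one_le_exp _)
    have hρτ : (1 - 1 / ((n : ℝ) - k)) ^ (k + 1) * ((2 * (n : ℝ) + k + 1) / (2 * n - k)) ≤ 1 := by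
      calc _ ≤ Real.exp (-((k + 1) / (n - k))) * Real.exp ((k + 1) / (n - k)) :=
            mul_le_mul hρ hτ (by positivity) (Real.exp_pos _).le
        _ = 1 := by rw [← Real.exp_add, neg_add_cancel, Real.exp_zero]
    have h3 : centralRatio (2 * n) k
        = centralRatio (2 * n) (k + 1) * ((2 * (n : ℝ) + k + 1) / (2 * n - k)) := by
      rw [mul_div_assoc', eq_div_iff h2n.ne', h1]
    have hρ0 : 0 ≤ (1 - 1 / ((n : ℝ) - k)) ^ (k + 1) := by
      apply pow_nonneg
      rw [sub_nonneg, div_le_one hd]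
      linarith
    rw [sortedProb_succ (by omega)]
    calc sortedProb n k * (1 - 1 / ((n : ℝ) - k)) ^ (k + 1)
        ≤ centralRatio (2 * n) k * (1 - 1 / ((n : ℝ) - k)) ^ (k + 1) :=
          mul_le_mul_of_nonneg_right (ih (by omega)) hρ0
      _ = centralRatio (2 * n) (k + 1) * ((1 - 1 / ((n : ℝ) - k)) ^ (k + 1)
            * ((2 * (n : ℝ) + k + 1) / (2 * n - k))) := by
          rw [h3]
          ring
      _ ≤ centralRatio (2 * n) (k + 1) :=
          mul_le_of_le_one_right (centralRatio_nonneg _ _) hρτ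

/-! ### Approximating the probabilities and summing -/

theorem log_ratio_succ {n k : ℕ} (h : 2 * (k + 1) ≤ n) {s : ℝ} (hs : 0 < s) (hn : s ^ 2 * n = 1) :
    Real.log (sortedProb n (k + 1) / centralRatio (2 * n) (k + 1))
      = Real.log (sortedProb n k / centralRatio (2 * n) k)
        + ((k * s + s) / s * Real.log (1 - s ^ 2 / (1 - s * (k * s)))
          + Real.log (1 + s * (k * s + s) / 2) - Real.log (1 - s * (k * s) / 2)) := by
  have hk : 2 * ((k : ℝ) + 1) ≤ n := by exact_mod_cast h
  have hk0 : (0 : ℝ) ≤ k := k.cast_nonneg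
  have hd : (0 : ℝ) < (n : ℝ) - k := by linarith
  have hn0 : (0 : ℝ) < n := by linarith
  have h2n : (0 : ℝ) < 2 * (n : ℝ) - k := by linarith
  have hs2 : s ^ 2 = 1 / n := by rw [eq_div_iff hn0.ne', hn]
  have e1 : 1 - s ^ 2 / (1 - s * (k * s)) = 1 - 1 / ((n : ℝ) - k) := by
    rw [show s * (k * s) = k * s ^ 2 by ring, hs2]
    field_simp
  have e2 : 1 + s * (k * s + s) / 2 = (2 * n + k + 1) / (2 * n) := by
    rw [show s * (k * s + s) = (k + 1) * s ^ 2 by ring, hs2]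
    field_simp
    ring
  have e3 : 1 - s * (k * s) / 2 = (2 * n - k) / (2 * n) := by
    rw [show s * (k * s) = k * s ^ 2 by ring, hs2]
    field_simp
  have e4 : (k * s + s) / s = ((k + 1 : ℕ) : ℝ) := by
    push_cast
    field_simp
  have hw := sortedProb_pos (by omega : k < n)
  have hv := centralRatio_pos (by omega : k ≤ 2 * n)
  have hv' := centralRatio_pos (by omega : k + 1 ≤ 2 * n)
  have h1 := centralRatio_succ_mul (by omega : k ≤ 2 * n)
  push_cast at h1
  have hρ : 0 < 1 - 1 / ((n : ℝ) - k) := by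
    rw [sub_pos, div_lt_one hd]
    linarith
  rw [e1, e2, e3, e4, sortedProb_succ (by omega),
    show centralRatio (2 * n) (k + 1) = centralRatio (2 * n) k * ((2 * n - k) / (2 * n + k + 1)) by
      rw [mul_div_assoc', eq_div_iff (by positivity), h1],
    Real.log_div (by positivity) (by positivity), Real.log_div hw.ne' hv.ne',
    Real.log_mul hw.ne' (by positivity), Real.log_mul hv.ne' (by positivity),
    Real.log_div h2n.ne' (by positivity), Real.log_div (by positivity) (by positivity),
    Real.log_div h2n.ne' (by positivity), Real.log_pow]
  ring

/-- Both sides vanish at `k = 0`, and `k` increments with error `O(s^7)` add up to `k s^7 = x s^6`.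
-/
theorem exists_abs_log_ratio_sub_le : ∃ C : ℝ, ∃ p : ℕ, 0 ≤ C ∧ ∀ n k : ℕ, ∀ s : ℝ, 0 < s →
    s ≤ 1 / 2 → s ^ 2 * n = 1 → 2 * k ≤ n →
    |Real.log (sortedProb n k / centralRatio (2 * n) k) - logPoly s (k * s)|
      ≤ C * s ^ 6 * (1 + k * s) ^ p := by
  obtain ⟨C, p, hC, hb⟩ := small_log_ratio
  refine ⟨C, p + 1, hC, fun n k s hs hs2 hn hk => ?_⟩
  have key : ∀ j, j ≤ k → |Real.log (sortedProb n j / centralRatio (2 * n) j) - logPoly s (j * s)|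
      ≤ j * (C * s ^ 7 * (1 + k * s) ^ p) := by
    intro j hj
    induction j with
    | zero => simp [sortedProb_zero, centralRatio_zero, logPoly]
    | succ j ih =>
      have hj1 : 2 * ((j : ℝ) + 1) ≤ n := by exact_mod_cast (by omega : 2 * (j + 1) ≤ n)
      have hjk : (j : ℝ) + 1 ≤ k := by exact_mod_cast hj
      have hj0 : (0 : ℝ) ≤ j := j.cast_nonneg
      have h1 := hb s (j * s) hs hs2 (by positivity) (by
        have : (s * (j * s)) = s ^ 2 * j := by ring
        simp only [this]
        nlinarith [sq_nonneg s])
      have h2 : (1 + j * s) ^ p ≤ (1 + k * s) ^ p := by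
        gcongr
        linarith
      have h3 : C * s ^ 7 * (1 + j * s) ^ p ≤ C * s ^ 7 * (1 + k * s) ^ p := by gcongr
      have h4 := abs_add_le (Real.log (sortedProb n j / centralRatio (2 * n) j) - logPoly s (j * s))
        (((j * s + s) / s * Real.log (1 - s ^ 2 / (1 - s * (j * s)))
          + Real.log (1 + s * (j * s + s) / 2) - Real.log (1 - s * (j * s) / 2))
          - (logPoly s (j * s + s) - logPoly s (j * s)))
      rw [log_ratio_succ (by omega) hs hn]
      push_cast
      rw [show ((j : ℝ) + 1) * s = j * s + s by ring]
      have h5 := ih (by omega)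
      refine le_trans (le_of_eq ?_) (h4.trans ?_)
      · congr 1
        ring
      · linarith
  refine (key k le_rfl).trans ?_
  have h6 : k * (C * s ^ 7 * (1 + k * s) ^ p) = C * s ^ 6 * (1 + k * s) ^ p * (k * s) := by ring
  rw [h6, pow_succ (1 + k * s), ← mul_assoc (C * s ^ 6)]
  apply mul_le_mul_of_nonneg_left _ (by positivity)
  linarith

/-- For `k ≤ n/2` the logarithmic expansion is exponentiated; since both logarithms are nonpositive,
`exp` is 1-Lipschitz between them. For larger `k` no expansion is needed. -/
theorem exists_abs_sortedProb_sub_le : ∃ C : ℝ, ∃ p : ℕ, 0 ≤ C ∧ ∀ n k : ℕ, ∀ s : ℝ, 0 < s →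
    s ≤ 1 / 2 → s ^ 2 * n = 1 →
    |sortedProb n k - centralRatio (2 * n) k * ratioPoly s (k * s)|
      ≤ centralRatio (2 * n) k * (C * s ^ 6 * (1 + k * s) ^ p) := by
  obtain ⟨C₁, p₁, hC₁, h₁⟩ := exists_abs_log_ratio_sub_le
  obtain ⟨C₂, p₂, hC₂, h₂⟩ := small_exp_logPoly_sub_ratioPoly (D := fun _ _ => True)
  obtain ⟨C₃, p₃, hC₃, h₃⟩ := small_ratioPoly (D := fun _ _ => True)
  refine ⟨C₁ + C₂ + 64 * (1 + C₃), p₁ + p₂ + (p₃ + 6), by positivity, fun n k s hs hs2 hn => ?_⟩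
  have hn0 : (0 : ℝ) < n := by
    by_contra h
    nlinarith [sq_nonneg s]
  have hn1 : 1 ≤ n := by exact_mod_cast hn0
  have hx : 0 ≤ k * s := by positivity
  have h1x : 1 ≤ 1 + k * s := by linarith
  set x : ℝ := k * s with hxdef
  have hv0 := centralRatio_nonneg (2 * n) k
  have hP : ∀ q, q ≤ p₁ + p₂ + (p₃ + 6) → (1 + x) ^ q ≤ (1 + x) ^ (p₁ + p₂ + (p₃ + 6)) :=
    fun q hq => pow_le_pow_right₀ h1x hq
  have hs6 : 0 ≤ s ^ 6 := by positivity
  by_cases hk : 2 * k ≤ n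
  · have hw := sortedProb_pos (by omega : k < n)
    have hv := centralRatio_pos (by omega : k ≤ 2 * n)
    have hle := sortedProb_le_centralRatio (by omega : k < n)
    have hl : Real.log (sortedProb n k / centralRatio (2 * n) k) ≤ 0 :=
      Real.log_nonpos (by positivity) ((div_le_one hv).2 hle)
    have hexp : sortedProb n k = centralRatio (2 * n) k *
        Real.exp (Real.log (sortedProb n k / centralRatio (2 * n) k)) := by
      rw [Real.exp_log (by positivity)]
      field_simp
    have e1 := (abs_exp_sub_exp_le hl (logPoly_nonpos hs hs2 hx)).trans (h₁ n k s hs hs2 hn hk)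
    have e2 := h₂ s x hs hs2 hx trivial
    rw [hexp, ← mul_sub, abs_mul, abs_of_nonneg hv0]
    generalize Real.log (sortedProb n k / centralRatio (2 * n) k) = l at *
    apply mul_le_mul_of_nonneg_left _ hv0
    have e3 := abs_sub_le (Real.exp l) (Real.exp (logPoly s x)) (ratioPoly s x)
    have e4 : C₁ * s ^ 6 * (1 + x) ^ p₁ ≤ C₁ * s ^ 6 * (1 + x) ^ (p₁ + p₂ + (p₃ + 6)) :=
      mul_le_mul_of_nonneg_left (hP _ (by omega)) (by positivity)
    have e5 : C₂ * s ^ 6 * (1 + x) ^ p₂ ≤ C₂ * s ^ 6 * (1 + x) ^ (p₁ + p₂ + (p₃ + 6)) :=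
      mul_le_mul_of_nonneg_left (hP _ (by omega)) (by positivity)
    have e6 : 0 ≤ 64 * (1 + C₃) * s ^ 6 * (1 + x) ^ (p₁ + p₂ + (p₃ + 6)) := by positivity
    linarith
  -- Here `s x > 1/2`, so `1 ≤ 2^6 s^6 (1 + x)^6` and the crude bound `w_k ≤ v_k` already has the
  -- required form.
  · have hk2 : (n : ℝ) < 2 * k := by exact_mod_cast not_le.1 hk
    have hsx : 1 ≤ 2 * (s * x) := by
      rw [hxdef, show s * (k * s) = s ^ 2 * k by ring]
      nlinarith [sq_nonneg s, pow_pos hs 2]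
    have hw : |sortedProb n k| ≤ centralRatio (2 * n) k := by
      by_cases hkn : k < n
      · rw [abs_of_pos (sortedProb_pos hkn)]
        exact sortedProb_le_centralRatio hkn
      · rw [sortedProb_eq_zero hn1 (by omega), abs_zero]
        exact hv0
    have e1 := h₃ s x hs hs2 hx trivial
    rw [pow_zero, mul_one] at e1
    have e2 : |sortedProb n k - centralRatio (2 * n) k * ratioPoly s x|
        ≤ centralRatio (2 * n) k * (1 + |ratioPoly s x|) := by
      refine (abs_sub _ _).trans ?_
      rw [abs_mul, abs_of_nonneg hv0]
      linarith
    refine e2.trans (mul_le_mul_of_nonneg_left ?_ hv0)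
    have e3 : (1 : ℝ) ≤ (1 + x) ^ p₃ := one_le_pow₀ h1x
    have e4 : 1 + |ratioPoly s x| ≤ (1 + C₃) * (1 + x) ^ p₃ := by linarith
    have e5 : (1 : ℝ) ≤ 64 * s ^ 6 * (1 + x) ^ 6 := by
      have : (2 * (s * x)) ^ 6 ≤ (2 * (s * (1 + x))) ^ 6 := by
        gcongr
        linarith
      calc (1 : ℝ) ≤ (2 * (s * x)) ^ 6 := one_le_pow₀ hsx
        _ ≤ _ := this
        _ = _ := by ring
    calc 1 + |ratioPoly s x| ≤ (1 + C₃) * (1 + x) ^ p₃ := e4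
      _ ≤ (1 + C₃) * (1 + x) ^ p₃ * (64 * s ^ 6 * (1 + x) ^ 6) :=
          le_mul_of_one_le_right (by positivity) e5
      _ = 64 * (1 + C₃) * s ^ 6 * (1 + x) ^ (p₃ + 6) := by ring
      _ ≤ 64 * (1 + C₃) * s ^ 6 * (1 + x) ^ (p₁ + p₂ + (p₃ + 6)) :=
          mul_le_mul_of_nonneg_left (hP _ (by omega)) (by positivity)
      _ ≤ _ := by
          gcongr
          linarith

theorem exists_abs_sum_sub_le : ∃ C : ℝ, ∀ n : ℕ, ∀ s : ℝ, 0 < s → s ≤ 1 / 2 →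
    s ^ 2 * n = 1 →
    |∑ k ∈ range n, ((k : ℝ) - 1) * sortedProb n k - (2 * n * summationPoly s 0
      + (-5 / 2 - 29 / 32 * s ^ 2 + 1955 / 9216 * s ^ 4) * ((invCentral (2 * n) + 1) / 2))|
      ≤ C * s ^ 4 := by
  obtain ⟨C₁, p₁, hC₁, h₁⟩ := exists_abs_sortedProb_sub_le
  obtain ⟨C₂, p₂, hC₂, h₂⟩ := small_summationPoly (D := fun _ _ => True)
  obtain ⟨K₁, hK₁, hs₁⟩ := sum_centralRatio_mul_pow_le (p₁ + 1)
  obtain ⟨K₂, hK₂, hs₂⟩ := sum_centralRatio_mul_pow_le p₂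
  refine ⟨C₁ * K₁ + C₂ * K₂, fun n s hs hs2 hn => ?_⟩
  have hn0 : (0 : ℝ) < n := by
    by_contra h
    nlinarith [sq_nonneg s]
  have hn1 : 1 ≤ n := by exact_mod_cast hn0
  -- `sortedProb` vanishes from `k = n` on, so the sum may run over the whole support of
  -- `centralRatio (2 * n)`.
  have hext : ∑ k ∈ range n, ((k : ℝ) - 1) * sortedProb n k
      = ∑ k ∈ range (2 * n + 1), ((k : ℝ) - 1) * sortedProb n k := by
    refine Finset.sum_subset (Finset.range_mono (by omega)) fun k _ hk => ?_
    rw [sortedProb_eq_zero hn1 (not_lt.1 fun h => hk (Finset.mem_range.2 h)), mul_zero]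
  set c : ℝ := -5 / 2 - 29 / 32 * s ^ 2 + 1955 / 9216 * s ^ 4 with hc
  have hparts := sum_centralRatio_mul_sub (2 * n) fun k => summationPoly s (k * s)
  have hV := sum_centralRatio (2 * n)
  have hsplit : ∑ k ∈ range (2 * n + 1), ((k : ℝ) - 1) * sortedProb n k
      - (2 * n * summationPoly s 0 + c * ((invCentral (2 * n) + 1) / 2))
      = ∑ k ∈ range (2 * n + 1), (((k : ℝ) - 1) *
          (sortedProb n k - centralRatio (2 * n) k * ratioPoly s (k * s))
        - centralRatio (2 * n) k * ((summationPoly s (k * s) * (2 / s ^ 2 + k * s / s)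
            - summationPoly s (k * s + s) * (2 / s ^ 2 - k * s / s))
          + c - (k * s / s - 1) * ratioPoly s (k * s))) := by
    have hsn : 2 / s ^ 2 = ((2 * n : ℕ) : ℝ) := by
      rw [div_eq_iff (by positivity)]
      push_cast
      linarith
    rw [← hV, Finset.mul_sum, show 2 * (n : ℝ) * summationPoly s 0
      = ((2 * n : ℕ) : ℝ) * summationPoly s ((0 : ℕ) * s) by simp, ← hparts,
      ← Finset.sum_add_distrib, ← Finset.sum_sub_distrib]
    refine Finset.sum_congr rfl fun k _ => ?_
    rw [hsn, mul_div_assoc, div_self hs.ne', mul_one, show ((k + 1 : ℕ) : ℝ) * s = k * s + s by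
      push_cast
      ring]
    ring
  rw [hext, hsplit]
  have hbound : ∀ k ∈ range (2 * n + 1), |((k : ℝ) - 1) *
          (sortedProb n k - centralRatio (2 * n) k * ratioPoly s (k * s))
        - centralRatio (2 * n) k * ((summationPoly s (k * s) * (2 / s ^ 2 + k * s / s)
            - summationPoly s (k * s + s) * (2 / s ^ 2 - k * s / s))
          + c - (k * s / s - 1) * ratioPoly s (k * s))|
      ≤ C₁ * s ^ 5 * (centralRatio (2 * n) k * (1 + k * s) ^ (p₁ + 1))
        + C₂ * s ^ 5 * (centralRatio (2 * n) k * (1 + k * s) ^ p₂) := by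
    intro k _
    have hk0 : (0 : ℝ) ≤ k := k.cast_nonneg
    have hv0 := centralRatio_nonneg (2 * n) k
    have e1 := h₁ n k s hs hs2 hn
    have e2 := h₂ s (k * s) hs hs2 (by positivity) trivial
    -- The weight `k - 1` costs one power of `s`, turning `s^6` into `s^5`.
    have e3 : |(k : ℝ) - 1| ≤ (1 + k * s) / s := by
      rw [le_div_iff₀ hs]
      have : |(k : ℝ) - 1| ≤ k + 1 := by
        rw [abs_le]
        constructor <;> linarith
      nlinarith
    refine (abs_sub _ _).trans (add_le_add ?_ ?_)
    · rw [abs_mul]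
      refine (mul_le_mul e3 e1 (abs_nonneg _) (by positivity)).trans (le_of_eq ?_)
      field_simp
      ring
    · rw [abs_mul, abs_of_nonneg hv0]
      refine (mul_le_mul_of_nonneg_left e2 hv0).trans (le_of_eq ?_)
      ring
  refine (Finset.abs_sum_le_sum_abs _ _).trans ((Finset.sum_le_sum hbound).trans ?_)
  rw [Finset.sum_add_distrib, ← Finset.mul_sum, ← Finset.mul_sum]
  have e1 := mul_le_mul_of_nonneg_left (hs₁ n s hs (by linarith) hn)
    (by positivity : 0 ≤ C₁ * s ^ 5)
  have e2 := mul_le_mul_of_nonneg_left (hs₂ n s hs (by linarith) hn)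
    (by positivity : 0 ≤ C₂ * s ^ 5)
  refine (add_le_add e1 e2).trans (le_of_eq ?_)
  field_simp

/-! ### Quantitative form of Wallis' product -/

theorem tendsto_div_self_of_eq {p : ℕ → ℝ} {a b c : ℝ}
    (hp : ∀ m, p m = m + a + b / m + c / m ^ 2) :
    Tendsto (fun m : ℕ => p m / m) atTop (nhds 1) := by
  have h := tendsto_one_div_atTop_nhds_zero_nat (𝕜 := ℝ)
  have h1 := ((tendsto_const_nhds (x := (1 : ℝ))).add (h.const_mul a)).add
    (((h.pow 2).const_mul b).add ((h.pow 3).const_mul c))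
  simp only [mul_zero, add_zero, ne_eq, OfNat.ofNat_ne_zero, not_false_eq_true, zero_pow] at h1
  refine h1.congr' ?_
  filter_upwards [eventually_gt_atTop 0] with m hm
  have : (m : ℝ) ≠ 0 := by positivity
  rw [hp]
  field_simp
  ring

theorem invCentral_sq_le_pi_mul {m : ℕ} (hm : 1 ≤ m) :
    invCentral m ^ 2 ≤ Real.pi * (m + 1 / 4 + 1 / (32 * m)) := by
  refine invCentral_sq_le (p := fun m : ℕ => (m : ℝ) + 1 / 4 + 1 / (32 * m))
    (fun m hm => by positivity)
    (tendsto_div_self_of_eq (a := 1 / 4) (b := 1 / 32) (c := 0) fun m => by ring)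
    (fun m hm => ?_) hm
  have hm0 : (0 : ℝ) < m := by exact_mod_cast hm
  rw [← sub_nonneg]
  have : (((m : ℝ) + 1 / 4 + 1 / (32 * m)) * (2 * m + 2) ^ 2
      - (((m + 1 : ℕ) : ℝ) + 1 / 4 + 1 / (32 * ((m + 1 : ℕ) : ℝ))) * (2 * m + 1) ^ 2)
      = (3 * m + 4) / (32 * m * (m + 1)) := by
    push_cast
    field_simp
    ring
  rw [this]
  positivity

theorem pi_mul_le_invCentral_sq {m : ℕ} (hm : 1 ≤ m) :
    Real.pi * (m + 1 / 4 + 1 / (32 * m) - 1 / (32 * m ^ 2)) ≤ invCentral m ^ 2 := by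
  refine le_invCentral_sq (p := fun m : ℕ => (m : ℝ) + 1 / 4 + 1 / (32 * m) - 1 / (32 * m ^ 2))
    (fun m hm => ?_)
    (tendsto_div_self_of_eq (a := 1 / 4) (b := 1 / 32) (c := -1 / 32) fun m => by ring)
    (fun m hm => ?_) hm
  · have hm0 : (1 : ℝ) ≤ m := by exact_mod_cast hm
    have h1 : 1 / (32 * (m : ℝ) ^ 2) ≤ 1 / (32 * m) := by
      apply one_div_le_one_div_of_le (by positivity)
      nlinarith
    linarith
  · have hm0 : (0 : ℝ) < m := by exact_mod_cast hm
    rw [← sub_nonneg]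
    have : ((((m + 1 : ℕ) : ℝ) + 1 / 4 + 1 / (32 * ((m + 1 : ℕ) : ℝ))
          - 1 / (32 * ((m + 1 : ℕ) : ℝ) ^ 2)) * (2 * m + 1) ^ 2)
        - ((m : ℝ) + 1 / 4 + 1 / (32 * m) - 1 / (32 * m ^ 2)) * (2 * m + 2) ^ 2
        = (9 * m ^ 3 + 16 * m ^ 2 + 12 * m + 4) / (32 * m ^ 2 * (m + 1) ^ 2) := by
      push_cast
      field_simp
      ring
    rw [this]
    positivity

/-- The factor `1 + 1/(8m) + 1/(128m²)` is the truncated square root of `1 + 1/(4m) + 1/(32m²)`. The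
two bounds on `invCentral m ^ 2` differ by `π/(32m²)`, and the square of the approximation exceeds
the upper one by at most `33π/16384 · 1/m²`. Dividing by a sum that is at least 1 suffices. -/
theorem abs_invCentral_sub_le {m : ℕ} (hm : 1 ≤ m) :
    |invCentral m - √(Real.pi * m) * (1 + 1 / (8 * m) + 1 / (128 * m ^ 2))|
      ≤ 1 / (m : ℝ) ^ 2 := by
  have hm1 : (1 : ℝ) ≤ m := by exact_mod_cast hm
  have hpi := Real.pi_gt_three
  have hpi4 := Real.pi_le_four
  have h1 := invCentral_sq_le_pi_mul hm
  have h2 := pi_mul_le_invCentral_sq hm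
  have hA := invCentral_pos m
  have hr : 1 ≤ √(Real.pi * m) := Real.one_le_sqrt.2 (by nlinarith)
  have hT : 1 ≤ 1 + 1 / (8 * (m : ℝ)) + 1 / (128 * m ^ 2) := by
    have : 0 ≤ 1 / (8 * (m : ℝ)) + 1 / (128 * m ^ 2) := by positivity
    linarith
  set B := √(Real.pi * m) * (1 + 1 / (8 * (m : ℝ)) + 1 / (128 * m ^ 2)) with hB
  have hB1 : 1 ≤ B := by nlinarith
  have hBsq : B ^ 2 = Real.pi * (m + 1 / 4 + 1 / (32 * m))
      + Real.pi * (1 / (512 * m ^ 2) + 1 / (16384 * m ^ 3)) := by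
    rw [hB, mul_pow, Real.sq_sqrt (by positivity)]
    field_simp
    ring
  have h3 : 1 / (16384 * (m : ℝ) ^ 3) ≤ 1 / (16384 * m ^ 2) := by
    apply one_div_le_one_div_of_le (by positivity)
    have : (m : ℝ) ^ 2 ≤ m ^ 3 := pow_le_pow_right₀ hm1 (by norm_num)
    linarith
  have h4 : |invCentral m ^ 2 - B ^ 2| ≤ 1 / m ^ 2 := by
    have e1 : 1 / (512 * (m : ℝ) ^ 2) = 1 / 512 * (1 / m ^ 2) := by ring
    have e2 : 1 / (16384 * (m : ℝ) ^ 2) = 1 / 16384 * (1 / m ^ 2) := by ring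
    have e3 : 1 / (32 * (m : ℝ) ^ 2) = 1 / 32 * (1 / m ^ 2) := by ring
    have h0 : 0 ≤ 1 / (m : ℝ) ^ 2 := by positivity
    have h5 : 0 ≤ 1 / (16384 * (m : ℝ) ^ 3) := by positivity
    rw [hBsq, abs_le]
    constructor
    · nlinarith
    · nlinarith
  have h5 : |invCentral m ^ 2 - B ^ 2| = |invCentral m - B| * (invCentral m + B) := by
    rw [sq_sub_sq, abs_mul, abs_of_pos (by linarith : 0 < invCentral m + B), mul_comm]
  rw [h5] at h4
  refine le_trans ?_ h4
  exact le_mul_of_one_le_right (abs_nonneg _) (by linarith)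

/-! ### The expansion of the saving -/

set_option maxHeartbeats 800000 in
theorem exists_abs_saving_sub_le : ∃ C : ℝ, ∀ n : ℕ, 4 ≤ n →
    |1 + ∑ k ∈ range n, ((k : ℝ) - 1) * sortedProb n k - expansion n
      - 347 / 4608 * √(2 * Real.pi) * (1 / (n * √n))| ≤ C * (1 / (n : ℝ) ^ 2) := by
  obtain ⟨C, hC⟩ := exists_abs_sum_sub_le
  -- `11 = 4 · 1/4 + 10`: the bound `hc` times the error `t^4 / 4` of `A`, plus the bound `hd`.
  refine ⟨C + 11, fun n hn4 => ?_⟩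
  have hn : (4 : ℝ) ≤ n := by exact_mod_cast hn4
  have hn0 : (0 : ℝ) < n := by linarith
  set r : ℝ := √n with hr
  have hr2 : r ^ 2 = n := Real.sq_sqrt hn0.le
  have hr0 : 0 < r := Real.sqrt_pos.2 hn0
  have hr1 : 2 ≤ r := Real.le_sqrt_of_sq_le (by linarith)
  have h1 := hC n (1 / r) (by positivity)
    (one_div_le_one_div_of_le two_pos hr1) (by rw [div_pow, hr2]; field_simp)
  have h2 := abs_invCentral_sub_le (by omega : 1 ≤ 2 * n)
  set q : ℝ := √(2 * Real.pi) with hq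
  have hq0 : 0 ≤ q := Real.sqrt_nonneg _
  have hq3 : q ≤ 3 := Real.sqrt_le_iff.2 ⟨by norm_num, by linarith [Real.pi_le_four]⟩
  have e1 : √(Real.pi * ((2 * n : ℕ) : ℝ)) = q * r := by
    rw [hq, hr, ← Real.sqrt_mul (by positivity)]
    congr 1
    push_cast
    ring
  have e2 : √(Real.pi * n / 2) = q * r / 2 := by
    rw [Real.sqrt_eq_iff_mul_self_eq (by positivity) (by positivity)]
    have : q ^ 2 = 2 * Real.pi := Real.sq_sqrt (by positivity)
    rw [← hr2]
    linear_combination -r ^ 2 / 4 * this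
  have e3 : √(Real.pi / (2 * n)) = q / (2 * r) := by
    rw [Real.sqrt_eq_iff_mul_self_eq (by positivity) (by positivity)]
    have : q ^ 2 = 2 * Real.pi := Real.sq_sqrt (by positivity)
    rw [← hr2]
    field_simp
    linear_combination -this
  rw [e1] at h2
  push_cast at h2
  have e4 : summationPoly (1 / r) 0 = 1 / 2 + 43 / 24 * (1 / r) ^ 2
      + 3659 / 17280 * (1 / r) ^ 4 := by
    unfold summationPoly
    norm_num
  rw [e4] at h1
  rw [expansion, e2, e3]
  generalize ∑ k ∈ range n, ((k : ℝ) - 1) * sortedProb n k = S at *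
  generalize invCentral (2 * n) = A at *
  rw [← hr2] at h1 h2 ⊢
  set M : ℝ := 2 * r ^ 2 * (1 / 2 + 43 / 24 * (1 / r) ^ 2 + 3659 / 17280 * (1 / r) ^ 4)
    + (-5 / 2 - 29 / 32 * (1 / r) ^ 2 + 1955 / 9216 * (1 / r) ^ 4) * ((A + 1) / 2) with hM
  set B : ℝ := q * r * (1 + 1 / (8 * (2 * r ^ 2)) + 1 / (128 * (2 * r ^ 2) ^ 2)) with hB
  set t : ℝ := 1 / r with ht
  have ht0 : 0 < t := by positivity
  have ht1 : t ≤ 1 := by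
    rw [ht, div_le_one hr0]
    linarith
  -- An exact identity. With `A` replaced by `B`, all terms down to `t^2` cancel against
  -- `expansion`, and the coefficient of `q t^3` is `-5/2048 - 29/1024 + 1955/18432 = 347/4608`;
  -- what is left is divisible by `t^4`.
  have hid : 1 + S - (r ^ 2 - 5 / 2 * (q * r / 2) + 10 / 3 - 17 / 16 * (q / (2 * r))
        - 4 / (135 * r ^ 2)) - 347 / 4608 * q * (1 / (r ^ 2 * r))
      = (S - M) + (-5 / 4 - 29 / 64 * t ^ 2 + 1955 / 18432 * t ^ 4) * (A - B)
        + (1955 / 18432 + q * ((1955 / 294912 - 29 / 32768) * t + 1955 / 9437184 * t ^ 3))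
          * t ^ 4 := by
    rw [hM, hB, ht]
    field_simp
    ring
  have ht4 : 1 / (r ^ 2) ^ 2 = t ^ 4 := by
    rw [ht]
    ring
  clear_value M B t
  have h3 : 1 / (2 * r ^ 2) ^ 2 = t ^ 4 / 4 := by
    rw [ht]
    ring
  rw [h3] at h2
  have ht2 : t ^ 2 ≤ 1 := pow_le_one₀ ht0.le ht1
  have ht3 : t ^ 3 ≤ 1 := pow_le_one₀ ht0.le ht1
  have ht41 : t ^ 4 ≤ 1 := pow_le_one₀ ht0.le ht1
  have ht40 : 0 ≤ t ^ 4 := by positivity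
  have hc : |-5 / 4 - 29 / 64 * t ^ 2 + 1955 / 18432 * t ^ 4| ≤ 4 := by
    rw [abs_le]
    constructor <;> nlinarith [sq_nonneg t]
  have hd : |1955 / 18432 + q * ((1955 / 294912 - 29 / 32768) * t + 1955 / 9437184 * t ^ 3)|
      ≤ 10 := by
    have h0 : 0 ≤ (1955 / 294912 - 29 / 32768) * t + 1955 / 9437184 * t ^ 3 := by
      have : 0 ≤ t ^ 3 := by positivity
      linarith
    have h1 : (1955 / 294912 - 29 / 32768) * t + 1955 / 9437184 * t ^ 3 ≤ 1 := by linarith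
    generalize (1955 / 294912 - 29 / 32768) * t + 1955 / 9437184 * t ^ 3 = y at h0 h1
    rw [abs_le]
    constructor <;> nlinarith
  rw [hid, ht4]
  refine (abs_add_three _ _ _).trans ?_
  rw [abs_mul, abs_mul, abs_of_nonneg ht40]
  have h5 := mul_le_mul hc h2 (abs_nonneg _) (by norm_num)
  have h6 := mul_le_mul_of_nonneg_right hd ht40
  linarith

/-- The difference is asymptotically equivalent to a nonzero multiple of `n^(-3/2)`, because the
remaining error `O(n^(-2))` is of smaller order. -/
theorem isTheta_saving (f : ℕ → ℝ)
    (hf : ∀ n, 1 ≤ n → f n = 1 + ∑ k ∈ range n, ((k : ℝ) - 1) * sortedProb n k) :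
    (fun n : ℕ => f n - expansion n) =Θ[atTop] fun n : ℕ => 1 / ((n : ℝ) * √(n : ℝ)) := by
  obtain ⟨C, hC⟩ := exists_abs_saving_sub_le
  have hκ : 347 / 4608 * √(2 * Real.pi) ≠ 0 := by positivity
  have hO : (fun n : ℕ => (f n - expansion n)
      - 347 / 4608 * √(2 * Real.pi) * (1 / ((n : ℝ) * √(n : ℝ))))
      =O[atTop] fun n : ℕ => 1 / (n : ℝ) ^ 2 := by
    refine IsBigO.of_bound C ?_
    filter_upwards [eventually_ge_atTop 4] with n hn
    rw [Real.norm_eq_abs, Real.norm_of_nonneg (by positivity), hf n (by omega)]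
    exact hC n hn
  have ho : (fun n : ℕ => 1 / (n : ℝ) ^ 2) =o[atTop] fun n : ℕ => 1 / ((n : ℝ) * √(n : ℝ)) := by
    have h0 : Tendsto (fun n : ℕ => 1 / √(n : ℝ)) atTop (nhds 0) :=
      (Real.tendsto_sqrt_atTop.comp tendsto_natCast_atTop_atTop).const_div_atTop 1
    refine isLittleO_of_tendsto' ?_ (h0.congr' ?_)
    · filter_upwards [eventually_gt_atTop 0] with n hn h
      have : (0 : ℝ) < n := by exact_mod_cast hn
      exact absurd h (by positivity)
    · filter_upwards [eventually_gt_atTop 0] with n hn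
      have hn0 : (0 : ℝ) < n := by exact_mod_cast hn
      have hs : √(n : ℝ) ^ 2 = n := Real.sq_sqrt hn0.le
      have hs0 : 0 < √(n : ℝ) := Real.sqrt_pos.2 hn0
      generalize √(n : ℝ) = r at *
      rw [← hs]
      field_simp
  have hequiv : (fun n : ℕ => f n - expansion n) ~[atTop]
      fun n : ℕ => 347 / 4608 * √(2 * Real.pi) * (1 / ((n : ℝ) * √(n : ℝ))) :=
    (isLittleO_const_mul_right_iff hκ).2 (hO.trans_isLittleO ho)
  exact hequiv.isTheta.trans ((isTheta_refl _ _).const_mul_left hκ)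

end BubbleSort

theorem mainTheorem9 (x : ∀ n : ℕ, Fin n → ℝ) (hx : ∀ n, Function.Injective (x n)) :
    ((fun n : ℕ =>
        (BubbleSort.expectedComparisons BubbleSort.plain (x n)
          - BubbleSort.expectedComparisons BubbleSort.optimized (x n))
        - BubbleSort.expansion n)
      =Θ[Filter.atTop] fun n : ℕ => 1 / ((n : ℝ) * √(n : ℝ))) ∧
    ((fun n : ℕ =>
        (BubbleSort.expectedComparisons BubbleSort.plain (x n)
          - BubbleSort.expectedComparisons BubbleSort.variant (x n))
        - BubbleSort.expansion n)
      =Θ[Filter.atTop] fun n : ℕ => 1 / ((n : ℝ) * √(n : ℝ))) := by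
  have h := BubbleSort.isTheta_saving _ fun n hn =>
    BubbleSort.expectedComparisons_sub hn (hx n)
  refine ⟨h, ?_⟩
  simp only [BubbleSort.expectedComparisons_variant]
  exact h
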